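/- **Setting.** Let $d\ge 1$, let $\|\cdot\|$ be the Euclidean norm on $\mathbb R^d$ and $B(x,r)$ the closed balls. For positive constants $\bar p,a_-,r_-,a_+,r_+$ let $\mathcal P$ be the class of probability distributions on $\mathbb R^d$ having a Lebesgue density $p\le\bar p$ with $\mathrm P(B(x,r))\ge a_-p(x)r^d$ for all $x\in\mathbb R^d$, $0<r\le r_-$, and $\mathrm P(B(x,r))\le a_+p(x)r^d$ for all $x$ with $p(x)>0$, $0<r\le r_+$. Let $\gamma,\rho>0$, let $\mathrm P_X\in\mathcal P$ have density $p$ and $\mathrm Q_X\in\mathcal P$ have density $q$, with $$\int \frac{q(x)}{p(x)^{\gamma}}\,dx<\infty,\qquad \int q(x)^{d/(\rho+d)}\,dx<\infty$$ (the first integrand is $0$ where $q=0$). Let $\beta\in(0,1]$, $F,L>0$, and let $f:\mathbb R^d\to\mathbb R$ satisfy $|f|\le F$ and $|f(x)-f(y)|\le L\|x-y\|^\beta$ for all $x,y$. Let $\varepsilon$ be a centered real random variable with $\mathbb E[\exp(\lambda_0|\varepsilon|)]\le\sigma_0$, $\lambda_0,\sigma_0>0$. The data are $n$ i.i.d. copies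 $(X_i,Y_i)$ of $(X,f(X)+\varepsilon)$, with $X\sim\mathrm P_X$ independent of $\varepsilon$, and, independently of these, $m$ i.i.d. copies $(X'_j,Y'_j)$ of $(X',f(X')+\varepsilon')$, with $X'\sim\mathrm Q_X$ independent of $\varepsilon'$ and $\varepsilon'$ distributed as $\varepsilon$. Let $Y_i(x)$ and $Y'_j(x)$ be the labels of the $i$-th and $j$-th nearest neighbours of $x$ in the two samples (ties broken by index). The two-sample standard $(k_{\mathrm P},k_{\mathrm Q})$-NN regressor is $$\hat f(x)=\frac1{k_{\mathrm P}+k_{\mathrm Q}}\Big[\sum_{i=1}^nY_i(x)\mathbf 1(i\le k_{\mathrm P})+\sum_{j=1}^mY'_j(x)\mathbf 1(j\le k_{\mathrm Q})\Big],$$ and its target risk is $\mathcal E_{\mathrm Q}(\hat f,f)=\int(\hat f(x)-f(x))^2\,d\mathrm Q_X(x)$. **Constants.** For $\tau>0$ and $K\ge1$ put $K_0=2K(2d+1)(4e)^{2d+1}$, $A=2d+\tau+\frac{\log K_0}{\log(2d)}$, $\lambda_\tau^+=\frac{4A+9}{4A+12}$, $B_\tau=\frac{2}{1-\lambda_\tau^+}$,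 $K_d=2(25/d)^d$, $H=\frac{\lambda_0^2}{8\sigma_0}$, $C_\tau=\frac{\max(0,\log K_d)+2d+\tau+1}{H}$. Put $\mathcal T_{\mathrm P}(t)=\int q(x)p(x)^{-t}\,dx$, $\mathcal T_{\mathrm Q}(t)=\int q(x)^{1-t}\,dx$ and, for $R\in\{\mathrm P,\mathrm Q\}$, $$C_R(\kappa,t)=\frac{2C_\tau}{\kappa}+\big[2L^2r_-^{2\beta}+8F^2\big]\Big(\frac{\kappa B_\tau}{a_-r_-^d}\Big)^{t}\mathcal T_R(t).$$ **Theorem.** Let $\tau>0$, $\kappa_{\mathrm P},\kappa_{\mathrm Q}>0$ and $$u_T=\gamma\wedge\frac{2\beta}{d},\quad u_M=\frac{\rho}{\rho+d}\wedge\frac{2\beta}{d},\quad r_T=\frac{u_T}{u_T+1}=\frac{\gamma}{\gamma+1}\wedge\frac{2\beta}{2\beta+d},\quad r_M=\frac{u_M}{u_M+1}=\frac{\rho}{2\rho+d}\wedge\frac{2\beta}{2\beta+d}.$$ Let $0<u\le u_T$ and $0<v\le u_M$, put $a=u/(u+1)$, $b=v/(v+1)$, and let $\hat f$ be the two-sample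 standard $(k_{\mathrm P},k_{\mathrm Q})$-NN regressor with $$k_{\mathrm P}=\big\lceil\kappa_{\mathrm P}\log(n+m)^{1-a}\,n^{a}\big\rceil,\qquad k_{\mathrm Q}=\big\lceil\kappa_{\mathrm Q}\log(n+m)^{1-b}\,m^{b}\big\rceil .$$ Then there are $N=N(a,\kappa_{\mathrm P})\ge2d$ and $M=M(b,\kappa_{\mathrm Q})\ge2d$, depending otherwise only on $d$ and $\tau$, such that for all $n\ge N$ and $m\ge M$, with probability at least $1-2n^{-\tau}-2m^{-\tau}$, $$\mathcal E_{\mathrm Q}(\hat f,f)\le\frac{\kappa_{\mathrm P}C_{\mathrm P}(\kappa_{\mathrm P},u)+\kappa_{\mathrm Q}C_{\mathrm Q}(\kappa_{\mathrm Q},v)}{\kappa_{\mathrm P}\wedge\kappa_{\mathrm Q}}\Bigg(\Big(\frac{n}{\log(n+m)}\Big)^{a}+\Big(\frac{m}{\log(n+m)}\Big)^{b}\Bigg)^{-1}.$$ The best rate is obtained for $u=u_T$, $v=u_M$, where $a=r_T$ and $b=r_M$. -/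

import Mathlib

open MeasureTheory ProbabilityTheory

noncomputable section

/-- The covariate space `ℝ^d` with the Euclidean norm. -/
abbrev Cov (d : ℕ) : Type := EuclideanSpace ℝ (Fin d)

/-- `P ∈ 𝓜(pbar)`: `P` is a probability distribution on `ℝ^d` with Lebesgue density `p`,
and `p ≤ pbar` everywhere. -/
structure IsBoundedDensity {d : ℕ} (pbar : ℝ) (P : Measure (Cov d)) (p : Cov d → ℝ) : Prop where
  measurable : Measurable p
  nonneg : ∀ x, 0 ≤ p x
  le_pbar : ∀ x, p x ≤ pbar
  eq_withDensity : P = volume.withDensity (fun x => ENNReal.ofReal (p x))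
  isProbability : IsProbabilityMeasure P

/-- `P ∈ 𝓟(pbar, a₋, r₋, a₊, r₊)`, with density `p`: minimal and maximal mass properties. -/
structure ClassP {d : ℕ} (pbar am rm ap rp : ℝ) (P : Measure (Cov d)) (p : Cov d → ℝ) : Prop
    extends IsBoundedDensity pbar P p where
  minimal_mass : ∀ x, ∀ r, 0 < r → r ≤ rm → am * p x * r ^ d ≤ P.real (Metric.closedBall x r)
  maximal_mass : ∀ x, 0 < p x → ∀ r, 0 < r → r ≤ rp →
    P.real (Metric.closedBall x r) ≤ ap * p x * r ^ d

/-- `𝓣_P(t) = ∫ q(x) / p(x)^t dx ∈ [0, ∞]`. The integrand is `0` where `q = 0`, and it is `∞`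
where `p = 0 < q` (for `t > 0`). -/
def ratioIntegral {d : ℕ} (p q : Cov d → ℝ) (t : ℝ) : ENNReal :=
  ∫⁻ x, ENNReal.ofReal (q x) / ENNReal.ofReal (p x) ^ t

/-- `𝓣_Q(t) = ∫ q(x)^(1 - t) dx ∈ [0, ∞]`. -/
def powerIntegral {d : ℕ} (q : Cov d → ℝ) (t : ℝ) : ENNReal :=
  ∫⁻ x, ENNReal.ofReal (q x) ^ (1 - t)

/-- `Q ∈ 𝓠(P, γ, ρ)`: `Q` (density `q`) lies in the same class `𝓟` as `P` (density `p`), the pair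
has density ratio exponent `γ`, and `Q` satisfies the pseudo-moment condition of order `ρ`. -/
structure ClassQ {d : ℕ} (pbar am rm ap rp : ℝ) (p : Cov d → ℝ) (γ ρ : ℝ)
    (Q : Measure (Cov d)) (q : Cov d → ℝ) : Prop
    extends ClassP pbar am rm ap rp Q q where
  density_ratio : ratioIntegral p q γ < ⊤
  pseudo_moment : ∫⁻ x, ENNReal.ofReal (q x) ^ ((d : ℝ) / (ρ + d)) < ⊤

/-- The Hölder ball `𝓗_β(F, L)`. -/
structure HolderBall {d : ℕ} (β F L : ℝ) (f : Cov d → ℝ) : Prop where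
  bounded : ∀ x, |f x| ≤ F
  holder : ∀ x y, |f x - f y| ≤ L * ‖x - y‖ ^ β

/-- `ν` is the law of a centred noise variable `ε` with `E exp(lam0 |ε|) ≤ sig0`. -/
structure NoiseLaw (lam0 sig0 : ℝ) (ν : Measure ℝ) : Prop where
  isProbability : IsProbabilityMeasure ν
  centered : ∫ e, e ∂ν = 0
  exp_moment : ∫⁻ e, ENNReal.ofReal (Real.exp (lam0 * |e|)) ∂ν ≤ ENNReal.ofReal sig0

/-- The law of `(X, f(X) + ε)` for independent `X ∼ P` and `ε ∼ ν`. Source and target share `f`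
and `ν`, which is the covariate shift assumption in this model. -/
def regressionLaw {d : ℕ} (P : Measure (Cov d)) (f : Cov d → ℝ) (ν : Measure ℝ) :
    Measure (Cov d × ℝ) :=
  (P.prod ν).map (fun z => (z.1, f z.1 + z.2))

/-- The joint law of an i.i.d. `n`-sample from the source and an independent i.i.d. `m`-sample
from the target. -/
def twoSampleLaw {d : ℕ} (n m : ℕ) (P Q : Measure (Cov d)) (f : Cov d → ℝ) (ν : Measure ℝ) :
    Measure ((Fin n → Cov d × ℝ) × (Fin m → Cov d × ℝ)) :=
  (Measure.pi fun _ => regressionLaw P f ν).prod (Measure.pi fun _ => regressionLaw Q f ν)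

/-- The label `Y_i(x)` of the `i`-th nearest neighbour of `x` in the sample `S` (`i` counted from
`0`). `Tuple.sort` orders the indices by increasing distance to `x`, ties by index. -/
def neighbourLabel {d n : ℕ} (S : Fin n → Cov d × ℝ) (x : Cov d) (i : Fin n) : ℝ :=
  (S (Tuple.sort (fun j => ‖x - (S j).1‖) i)).2

/-- The two-sample local `(kP, kQ)`-nearest neighbours estimator. -/
def twoSampleKNN {d n m : ℕ} (kP kQ : Cov d → ℕ)
    (S : (Fin n → Cov d × ℝ) × (Fin m → Cov d × ℝ)) (x : Cov d) : ℝ :=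
  1 / ((kP x : ℝ) + (kQ x : ℝ)) *
    ((∑ i : Fin n, if (i : ℕ) + 1 ≤ kP x then neighbourLabel S.1 x i else 0) +
     (∑ j : Fin m, if (j : ℕ) + 1 ≤ kQ x then neighbourLabel S.2 x j else 0))

/-- The excess risk `∫ (g(x) - f(x))² dQ(x) ∈ [0, ∞]`. -/
def excessRisk {d : ℕ} (Q : Measure (Cov d)) (g f : Cov d → ℝ) : ENNReal :=
  ∫⁻ x, ENNReal.ofReal ((g x - f x) ^ 2) ∂Q

/-- `⌈κ log(n + m)^(1 / (t + 1)) s^(t / (t + 1))⌉`, the number of neighbours used in a sample of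
size `s`, where `total = n + m`. -/
def numNeighbours (κ t : ℝ) (total s : ℕ) : ℕ :=
  ⌈κ * Real.log (total : ℝ) ^ (1 / (t + 1)) * (s : ℝ) ^ (t / (t + 1))⌉₊

/-- `C_τ = (log⁺ K_d + 2 d + τ + 1) / H`, with `K_d = 2 (25 / d)^d`, `H = lam0² / (8 sig0)`. -/
def varianceConst (d : ℕ) (τ lam0 sig0 : ℝ) : ℝ :=
  (max 0 (Real.log (2 * (25 / (d : ℝ)) ^ d)) + 2 * d + τ + 1) / (lam0 ^ 2 / (8 * sig0))

/-- `K_0 = 2 K (2 d + 1) (4 e)^(2 d + 1)`. -/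
def coveringConst (d : ℕ) (K : ℝ) : ℝ :=
  2 * K * (2 * d + 1) * (4 * Real.exp 1) ^ (2 * d + 1)

/-- `λ_τ⁺ = (4 a + 9) / (4 a + 12)` with `a = 2 d + τ + log K_0 / log (2 d)`. -/
def lambdaPlus (d : ℕ) (τ K : ℝ) : ℝ :=
  (4 * (2 * d + τ + Real.log (coveringConst d K) / Real.log (2 * d)) + 9) /
    (4 * (2 * d + τ + Real.log (coveringConst d K) / Real.log (2 * d)) + 12)

/-- `B_τ = 2 / (1 - λ_τ⁺)`. -/
def radiusConst (d : ℕ) (τ K : ℝ) : ℝ :=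
  2 / (1 - lambdaPlus d τ K)

/-- The constant of the one-sample rate,
`2 C_τ / κ + (2 L² r₋^(2 β) + 8 F²) (κ B_τ / (a₋ r₋^d))^t T`. -/
def rateConst (d : ℕ) (τ K lam0 sig0 β F L am rm κ t T : ℝ) : ℝ :=
  2 * varianceConst d τ lam0 sig0 / κ +
    (2 * L ^ 2 * rm ^ (2 * β) + 8 * F ^ 2) * (κ * radiusConst d τ K / (am * rm ^ d)) ^ t * T

end

/-! Let U(x) and V(x) be the sums of Y − f(x) over the source and the target neighbours of x, so
that the error at x is (U + V)/(kP + kQ). By Cauchy–Schwarz (`add_sq_div_add_le`), (U + V)²/(kP +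
kQ) ≤ U²/kP + V²/kQ, so the samples decouple. It suffices to bound ∫U²/kP dQ by κP C_P log(n + m)
outside probability 2n^(-τ), and likewise for V (`one_sample_bound`), because kP + kQ is at least
log(n + m) (κP ∧ κQ) times the bracket in the rate. The target sample is the source bound with P =
Q.

No control uniform in x is needed: the risk is a Q-average, so Markov's inequality for the Q-average
of a weight W whose expectation is tiny at each x is enough (`measure_lintegral_ge_le`).

Noise (`noise_bound`): given the covariates, the neighbour set is fixed and the noise sum has
sub-Gaussian exponential moments for small parameters. Its square is at most a multiple of log n
plus a small multiple of an exponential weight.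

Bias (`bias_bound`): the minimal mass property gives a radius R(x) of order (k/(n p(x)))^(1/d) whose
ball has mass at least 4k/n. By a Chernoff bound it contains k sample points except with probability
e^(-k), and then Hölder continuity applies. Elsewhere, and where p is too small for such a radius,
boundedness of f is used. As u ≤ 2β/d, the normalised squared bias is at most a multiple of (k/(n
p))^u, and its Q-average produces 𝓣(u).

The prescribed k balances k (k/n)^u against log(n + m) (`exists_sample_size`). -/

/-! ### Elementary inequalities for the exponential -/

theorem Real.exp_le_one_add_add_sq_mul_exp_abs (x : ℝ) :
    Real.exp x ≤ 1 + x + x ^ 2 / 2 * Real.exp |x| := by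
  rcases le_total 0 x with hx | hx
  -- After multiplication by exp(-x) the claim says that this function is at least its value 1 at 0;
  -- its derivative is t (1 - exp(-t)).
  · have hmono : MonotoneOn (fun t : ℝ => (1 + t) * Real.exp (-t) + t ^ 2 / 2) (Set.Ici 0) := by
      apply monotoneOn_of_deriv_nonneg (convex_Ici 0)
      · fun_prop
      · fun_prop
      · intro t ht
        rw [interior_Ici] at ht
        have ht' : 0 < t := ht
        have h : HasDerivAt (fun t : ℝ => (1 + t) * Real.exp (-t) + t ^ 2 / 2)
            (1 * Real.exp (-t) + (1 + t) * (Real.exp (-t) * (-1)) + (2 : ℕ) * t ^ (2 - 1) / 2) t := by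
          have h1 : HasDerivAt (fun t : ℝ => 1 + t) 1 t := (hasDerivAt_id t).const_add 1
          have h2 : HasDerivAt (fun t : ℝ => Real.exp (-t)) (Real.exp (-t) * (-1)) t :=
            (hasDerivAt_neg t).exp
          exact (h1.mul h2).add ((hasDerivAt_pow 2 t).div_const 2)
        rw [h.deriv]
        have : Real.exp (-t) ≤ 1 := Real.exp_le_one_iff.2 (by linarith)
        norm_num
        nlinarith
    have h := hmono (Set.mem_Ici.2 le_rfl) (Set.mem_Ici.2 hx) hx
    simp only [add_zero, neg_zero, Real.exp_zero] at h
    rw [abs_of_nonneg hx]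
    have hp := Real.exp_pos x
    have he : Real.exp (-x) * Real.exp x = 1 := by rw [← Real.exp_add]; simp
    nlinarith
  -- For x ≤ 0 the quadratic lower bound at -x is inverted: (1 - x + x²/2)(1 + x + x²/2) = 1 + x⁴/4
  -- ≥ 1.
  · have h1 : 1 + (-x) + (-x) ^ 2 / 2 ≤ Real.exp (-x) :=
      Real.quadratic_le_exp_of_nonneg (by linarith)
    have h2 : (1 : ℝ) ≤ Real.exp |x| := Real.one_le_exp (abs_nonneg x)
    have he : Real.exp (-x) * Real.exp x = 1 := by rw [← Real.exp_add]; simp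
    have hp := Real.exp_pos x
    have h3 : Real.exp x ≤ 1 + x + x ^ 2 / 2 := by
      have h4 : (1 + (-x) + (-x) ^ 2 / 2) * Real.exp x ≤ 1 := by
        exact (mul_le_mul_of_nonneg_right h1 hp.le).trans_eq he
      have h5 : 0 < 1 + (-x) + (-x) ^ 2 / 2 := by nlinarith [sq_nonneg x]
      have h6 : (1 + (-x) + (-x) ^ 2 / 2) * (1 + x + x ^ 2 / 2) = 1 + x ^ 4 / 4 := by ring
      have h7 : (0 : ℝ) ≤ x ^ 4 := by positivity
      by_contra! h8
      nlinarith [mul_lt_mul_of_pos_left h8 h5]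
    nlinarith [sq_nonneg x]

/-- The maximum of y² exp(-y/2) is 16 exp(-2) < 3. Half of an exponential moment can thus absorb a
square. -/
theorem Real.sq_le_three_mul_exp_half {y : ℝ} (hy : 0 ≤ y) : y ^ 2 ≤ 3 * Real.exp (y / 2) := by
  have h1 : y / 4 ≤ Real.exp (y / 4 - 1) := by linarith [Real.add_one_le_exp (y / 4 - 1)]
  have h2 : (y / 4) ^ 2 ≤ Real.exp (y / 4 - 1) ^ 2 := pow_le_pow_left₀ (by positivity) h1 2
  have h3 : Real.exp (y / 4 - 1) ^ 2 = Real.exp (y / 2) * Real.exp (-1) ^ 2 := by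
    rw [← Real.exp_nat_mul, ← Real.exp_nat_mul, ← Real.exp_add]; congr 1; push_cast; ring
  have h4 : Real.exp (-1) < 0.3678794412 := Real.exp_neg_one_lt_d9
  have h5 : 0 < Real.exp (-1) := Real.exp_pos _
  have h6 : Real.exp (-1) ^ 2 ≤ 0.15 := by nlinarith
  have h7 := Real.exp_pos (y / 2)
  nlinarith

/-- Quadratic growth is dominated by a constant plus a small exponential. -/
theorem sq_le_sq_mul_one_add_exp {b y : ℝ} (hb : 6 ≤ b) (hy : 0 ≤ y) :
    y ^ 2 ≤ b ^ 2 * (1 + Real.exp (y - b) / 2) := by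
  have hp := Real.exp_pos (y - b)
  rcases le_total y b with h | h
  · have : y ^ 2 ≤ b ^ 2 := pow_le_pow_left₀ hy h 2
    nlinarith [mul_nonneg (sq_nonneg b) hp.le]
  · obtain ⟨t, rfl⟩ : ∃ t, y = b + t := ⟨y - b, by ring⟩
    have ht : 0 ≤ t := by linarith
    have h1 := Real.quadratic_le_exp_of_nonneg ht
    rw [add_sub_cancel_left]
    have h2 : 0 ≤ b ^ 2 * (Real.exp t - (1 + t + t ^ 2 / 2)) :=
      mul_nonneg (sq_nonneg b) (by linarith)
    nlinarith [mul_nonneg ht (mul_nonneg (by linarith : (0:ℝ) ≤ b) (by linarith : (0:ℝ) ≤ b - 6)),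
      mul_nonneg (mul_nonneg ht ht) (by nlinarith : (0:ℝ) ≤ b ^ 2 - 36), mul_nonneg ht ht]

/-! ### Markov's inequality and product integrals -/

/-- Markov's inequality for an average of non-negative functions. -/
theorem measure_lintegral_ge_le {Ω X : Type*} [MeasurableSpace Ω] [MeasurableSpace X]
    (μ : Measure Ω) (Q : Measure X) [SFinite μ] [IsProbabilityMeasure Q]
    {W : Ω → X → ENNReal} (hW : Measurable (Function.uncurry W)) {η : ENNReal}
    (hη : ∀ x, ∫⁻ S, W S x ∂μ ≤ η) {c : ENNReal} (hc0 : c ≠ 0) (hc : c ≠ ⊤) :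
    μ {S | c ≤ ∫⁻ x, W S x ∂Q} ≤ η / c := by
  have h1 : ∫⁻ S, ∫⁻ x, W S x ∂Q ∂μ ≤ η := by
    rw [lintegral_lintegral_swap hW.aemeasurable]
    calc _ ≤ ∫⁻ _, η ∂Q := lintegral_mono hη
      _ = η := by simp
  rw [ENNReal.le_div_iff_mul_le (Or.inl hc0) (Or.inl hc), mul_comm]
  exact (mul_meas_ge_le_lintegral hW.lintegral_prod_right' c).trans h1

theorem lintegral_pi_prod {ι E : Type*} [Fintype ι] [MeasurableSpace E] (μ : Measure E)
    [IsProbabilityMeasure μ] {g : ι → E → ENNReal} (hg : ∀ i, Measurable (g i)) :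
    ∫⁻ z, ∏ i, g i (z i) ∂(Measure.pi fun _ : ι => μ) = ∏ i, ∫⁻ e, g i e ∂μ := by
  refine (lintegral_prod_eq_prod_lintegral_of_indepFun Finset.univ
    (fun i (z : ι → E) => g i (z i))
    (iIndepFun_pi (X := g) (μ := fun _ => μ) fun i => (hg i).aemeasurable)
    fun i => (hg i).comp (measurable_pi_apply i)).trans ?_
  refine Finset.prod_congr rfl fun i _ => ?_
  exact (measurePreserving_eval (fun _ : ι => μ) i).lintegral_comp (hg i)

/-! ### Exponential moments of the noise -/

namespace NoiseLaw

theorem one_le {lam0 sig0 : ℝ} {ν : Measure ℝ} (hν : NoiseLaw lam0 sig0 ν) (hl : 0 < lam0) :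
    1 ≤ sig0 := by
  have := hν.isProbability
  have h : (1 : ENNReal) ≤ ENNReal.ofReal sig0 := by
    refine le_trans ?_ hν.exp_moment
    calc (1 : ENNReal) = ∫⁻ _, 1 ∂ν := by simp
      _ ≤ _ := lintegral_mono fun e => by
        simpa using ENNReal.ofReal_le_ofReal (Real.one_le_exp (by positivity : 0 ≤ lam0 * |e|))
  simpa using h

/-- Second-order expansion: centring removes the linear term. Since |s| ≤ lam0 / 2, the remainder
uses half of the exponential moment, and the other half absorbs the square. -/
theorem lintegral_exp_mul_le {lam0 sig0 : ℝ} {ν : Measure ℝ} (hν : NoiseLaw lam0 sig0 ν)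
    (hl : 0 < lam0) {s : ℝ} (hs : |s| ≤ lam0 / 2) :
    ∫⁻ e, ENNReal.ofReal (Real.exp (s * e)) ∂ν
      ≤ ENNReal.ofReal (Real.exp (3 * sig0 / (2 * lam0 ^ 2) * s ^ 2)) := by
  have := hν.isProbability
  have hs0 : 0 < sig0 := by linarith [hν.one_le hl]
  have hE : Integrable (fun e => Real.exp (lam0 * |e|)) ν := by
    refine ⟨by fun_prop, ?_⟩
    rw [hasFiniteIntegral_iff_ofReal (Filter.Eventually.of_forall fun _ => (Real.exp_pos _).le)]
    exact hν.exp_moment.trans_lt ENNReal.ofReal_lt_top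
  have hEle : ∫ e, Real.exp (lam0 * |e|) ∂ν ≤ sig0 := by
    rw [integral_eq_lintegral_of_nonneg_ae (Filter.Eventually.of_forall fun _ => (Real.exp_pos _).le)
      (by fun_prop)]
    exact ENNReal.toReal_le_of_le_ofReal hs0.le hν.exp_moment
  have hid : Integrable (fun e : ℝ => e) ν := by
    refine (hE.const_mul (1 / lam0)).mono' (by fun_prop) (Filter.Eventually.of_forall fun e => ?_)
    rw [Real.norm_eq_abs, one_div, ← div_eq_inv_mul, le_div_iff₀ hl]
    linarith [Real.add_one_le_exp (lam0 * |e|)]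
  have hpt : ∀ e, Real.exp (s * e)
      ≤ 1 + s * e + 3 * s ^ 2 / (2 * lam0 ^ 2) * Real.exp (lam0 * |e|) := by
    intro e
    refine (Real.exp_le_one_add_add_sq_mul_exp_abs (s * e)).trans ?_
    have h1 : Real.exp |s * e| ≤ Real.exp (lam0 * |e| / 2) := by
      rw [abs_mul]; apply Real.exp_le_exp.2; nlinarith [abs_nonneg e]
    have h2 := Real.sq_le_three_mul_exp_half (y := lam0 * |e|) (by positivity)
    have h3 : Real.exp (lam0 * |e|) = Real.exp (lam0 * |e| / 2) * Real.exp (lam0 * |e| / 2) := by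
      rw [← Real.exp_add]; ring_nf
    have h4 : (s * e) ^ 2 / 2 = s ^ 2 / (2 * lam0 ^ 2) * (lam0 * |e|) ^ 2 := by
      rw [mul_pow, mul_pow, sq_abs]; field_simp
    rw [h3, h4]
    have h5 : 0 ≤ s ^ 2 / (2 * lam0 ^ 2) := by positivity
    have h6 := Real.exp_pos (lam0 * |e| / 2)
    calc _ ≤ 1 + s * e + s ^ 2 / (2 * lam0 ^ 2) * (3 * Real.exp (lam0 * |e| / 2)) *
          Real.exp (lam0 * |e| / 2) := by gcongr
      _ = _ := by ring
  have hA : Integrable (fun e => 1 + s * e) ν := (integrable_const _).add (hid.const_mul s)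
  have hR : Integrable (fun e => 1 + s * e + 3 * s ^ 2 / (2 * lam0 ^ 2) * Real.exp (lam0 * |e|)) ν :=
    hA.add (hE.const_mul _)
  calc _ ≤ ∫⁻ e, ENNReal.ofReal
        (1 + s * e + 3 * s ^ 2 / (2 * lam0 ^ 2) * Real.exp (lam0 * |e|)) ∂ν :=
        lintegral_mono fun e => ENNReal.ofReal_le_ofReal (hpt e)
    _ = ENNReal.ofReal (∫ e, 1 + s * e + 3 * s ^ 2 / (2 * lam0 ^ 2) * Real.exp (lam0 * |e|) ∂ν) :=
        (ofReal_integral_eq_lintegral_ofReal hR (Filter.Eventually.of_forall fun e =>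
          (Real.exp_pos _).le.trans (hpt e))).symm
    _ ≤ _ := by
      apply ENNReal.ofReal_le_ofReal
      rw [integral_add hA (hE.const_mul _),
        integral_add (integrable_const _) (hid.const_mul s), integral_const_mul, integral_const_mul,
        hν.centered]
      simp only [integral_const, probReal_univ, smul_eq_mul, mul_one, mul_zero, add_zero]
      refine le_trans ?_ (Real.add_one_le_exp _)
      have : 3 * s ^ 2 / (2 * lam0 ^ 2) * ∫ e, Real.exp (lam0 * |e|) ∂ν
          ≤ 3 * s ^ 2 / (2 * lam0 ^ 2) * sig0 := by gcongr
      calc _ ≤ 1 + 3 * s ^ 2 / (2 * lam0 ^ 2) * sig0 := by linarith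
        _ = _ := by ring

end NoiseLaw

/-! ### Neighbour sums and their measurability -/

/-- The sum of `g` over the `k` nearest neighbours of `x` in the sample `S` (over the whole sample
if `k` exceeds its size). -/
noncomputable def neighbourSum {d n : ℕ} (k : ℕ) (g : Cov d × ℝ → ℝ) (S : Fin n → Cov d × ℝ) (x : Cov d) : ℝ :=
  ∑ i : Fin n, if (i : ℕ) + 1 ≤ k then g (S (Tuple.sort (fun j => ‖x - (S j).1‖) i)) else 0

/-- The sorting permutation is determined by finitely many comparisons of distances. Joint
measurability in sample and point is what allows integrals over the two to be exchanged. -/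
theorem measurableSet_sort_eq {d n : ℕ} (σ : Equiv.Perm (Fin n)) :
    MeasurableSet {z : (Fin n → Cov d × ℝ) × Cov d |
      σ = Tuple.sort (fun j => ‖z.2 - (z.1 j).1‖)} := by
  simp only [Tuple.eq_sort_iff, Monotone, Function.comp]
  have hm : ∀ j : Fin n, Measurable fun z : (Fin n → Cov d × ℝ) × Cov d => ‖z.2 - (z.1 j).1‖ :=
    fun j => by fun_prop
  refine MeasurableSet.inter ?_ ?_
  · refine MeasurableSet.congr (s := ⋂ i, ⋂ j, ⋂ _ : i ≤ j, {z : (Fin n → Cov d × ℝ) × Cov d |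
      ‖z.2 - (z.1 (σ i)).1‖ ≤ ‖z.2 - (z.1 (σ j)).1‖}) ?_ ?_
    · exact .iInter fun i => .iInter fun j => .iInter fun _ => measurableSet_le (hm _) (hm _)
    · ext z; simp; rfl
  · refine MeasurableSet.congr (s := ⋂ i, ⋂ j, ⋂ _ : i < j, {z : (Fin n → Cov d × ℝ) × Cov d |
      ‖z.2 - (z.1 (σ i)).1‖ = ‖z.2 - (z.1 (σ j)).1‖ → σ i < σ j}) ?_ ?_
    · refine .iInter fun i => .iInter fun j => .iInter fun _ => ?_
      by_cases h : σ i < σ j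
      · simp [h]
      · simp only [h, imp_false]
        exact (measurableSet_eq_fun (hm (σ i)) (hm (σ j))).compl
    · ext z; simp; rfl

theorem measurable_sort_apply {d n : ℕ} (i : Fin n) :
    Measurable fun z : (Fin n → Cov d × ℝ) × Cov d =>
      Tuple.sort (fun j => ‖z.2 - (z.1 j).1‖) i := by
  refine measurable_to_countable' fun j => ?_
  have : (fun z : (Fin n → Cov d × ℝ) × Cov d =>
      Tuple.sort (fun j => ‖z.2 - (z.1 j).1‖) i) ⁻¹' {j} =
      ⋃ σ : Equiv.Perm (Fin n), ⋃ _ : σ i = j, {z : (Fin n → Cov d × ℝ) × Cov d |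
        σ = Tuple.sort (fun j => ‖z.2 - (z.1 j).1‖)} := by
    ext z; simp
  rw [this]
  exact .iUnion fun σ => .iUnion fun _ => measurableSet_sort_eq σ

theorem measurable_neighbourSum {d n : ℕ} (k : ℕ) {g : Cov d × ℝ → ℝ} (hg : Measurable g) :
    Measurable fun z : (Fin n → Cov d × ℝ) × Cov d => neighbourSum k g z.1 z.2 := by
  unfold neighbourSum
  refine Finset.measurable_sum _ fun i _ => ?_
  split_ifs
  · have h : Measurable fun w : ((Fin n → Cov d × ℝ) × Cov d) × Fin n => g (w.1.1 w.2) :=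
      measurable_from_prod_countable_left fun j =>
        hg.comp ((measurable_pi_apply j).comp measurable_fst)
    exact h.comp (measurable_id.prodMk (measurable_sort_apply i))
  · exact measurable_const

/-- The indices of the `k` nearest neighbours of `x`. -/
noncomputable def neighbourSet {d n : ℕ} (k : ℕ) (X : Fin n → Cov d) (x : Cov d) : Finset (Fin n) :=
  (Finset.univ.filter fun i : Fin n => (i : ℕ) < k).map
    (Tuple.sort (fun j => ‖x - X j‖)).toEmbedding

theorem card_neighbourSet {d n : ℕ} (k : ℕ) (X : Fin n → Cov d) (x : Cov d) :
    (neighbourSet k X x).card = min k n := by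
  rw [neighbourSet, Finset.card_map, Fin.card_filter_val_lt, min_comm]

theorem neighbourSum_eq {d n : ℕ} (k : ℕ) (g : Cov d × ℝ → ℝ) (S : Fin n → Cov d × ℝ)
    (x : Cov d) : neighbourSum k g S x = ∑ j ∈ neighbourSet k (fun j => (S j).1) x, g (S j) := by
  rw [neighbourSet, Finset.sum_map, neighbourSum, Finset.sum_filter]
  rfl

/-- A neighbour is within distance `r` of `x` as soon as `k` sample points are. -/
theorem norm_sub_le_of_mem_neighbourSet {d n k : ℕ} {X : Fin n → Cov d} {x : Cov d} {r : ℝ}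
    (h : k ≤ (Finset.univ.filter fun j => ‖x - X j‖ ≤ r).card) {j : Fin n}
    (hj : j ∈ neighbourSet k X x) : ‖x - X j‖ ≤ r := by
  obtain ⟨i, hi, rfl⟩ := Finset.mem_map.1 hj
  have hik : (i : ℕ) < k := by simpa using hi
  have hm := Tuple.monotone_sort fun j => ‖x - X j‖
  -- In a sorted sequence indexed from 0, entry i is at most r exactly when more than i entries are.
  have h2 := (Tuple.lt_card_le_iff_apply_le_of_monotone (j := i) (a := r) hm).1 (by
    refine (hik.trans_le h).trans_eq ?_
    rw [← Finset.card_map (Tuple.sort fun j => ‖x - X j‖).symm.toEmbedding]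
    congr 1
    ext l
    simp)
  exact h2

/-! ### The sample law and the noise term -/

theorem isProbabilityMeasure_regressionLaw {d : ℕ} (P : Measure (Cov d)) (ν : Measure ℝ)
    [IsProbabilityMeasure P] [IsProbabilityMeasure ν] {f : Cov d → ℝ} (hf : Measurable f) :
    IsProbabilityMeasure (regressionLaw P f ν) :=
  Measure.isProbabilityMeasure_map (by fun_prop)

/-- Separates covariates from noise, so that one can fix the covariates and integrate over the noise
alone. -/
theorem pi_regressionLaw {d : ℕ} (n : ℕ) (P : Measure (Cov d)) (ν : Measure ℝ)
    [IsProbabilityMeasure P] [IsProbabilityMeasure ν] {f : Cov d → ℝ} (hf : Measurable f) :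
    (Measure.pi fun _ : Fin n => regressionLaw P f ν) =
      ((Measure.pi fun _ : Fin n => P).prod (Measure.pi fun _ : Fin n => ν)).map
        fun z i => (z.1 i, f (z.1 i) + z.2 i) := by
  have hφ : Measurable fun z : Cov d × ℝ => (z.1, f z.1 + z.2) := by fun_prop
  have : IsProbabilityMeasure ((P.prod ν).map fun z : Cov d × ℝ => (z.1, f z.1 + z.2)) :=
    Measure.isProbabilityMeasure_map hφ.aemeasurable
  rw [← (measurePreserving_arrowProdEquivProdArrow (Cov d) ℝ (Fin n) (fun _ => P)
    (fun _ => ν)).map_eq, Measure.map_map (by fun_prop) (MeasurableEquiv.measurable _)]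
  unfold regressionLaw
  rw [← Measure.pi_map_pi (μ := fun _ : Fin n => P.prod ν)
    (f := fun _ z => (z.1, f z.1 + z.2)) fun _ => hφ.aemeasurable]
  rfl

theorem lintegral_pi_regressionLaw {d n : ℕ} (P : Measure (Cov d)) (ν : Measure ℝ)
    [IsProbabilityMeasure P] [IsProbabilityMeasure ν] {f : Cov d → ℝ} (hf : Measurable f)
    {W : (Fin n → Cov d × ℝ) → ENNReal} (hW : Measurable W) :
    ∫⁻ S, W S ∂(Measure.pi fun _ : Fin n => regressionLaw P f ν) =
      ∫⁻ X, ∫⁻ e, W (fun i => (X i, f (X i) + e i)) ∂(Measure.pi fun _ : Fin n => ν)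
        ∂(Measure.pi fun _ : Fin n => P) := by
  have hm : Measurable fun (z : (Fin n → Cov d) × (Fin n → ℝ)) i =>
      (z.1 i, f (z.1 i) + z.2 i) := by fun_prop
  rw [pi_regressionLaw n P ν hf, lintegral_map hW hm, lintegral_prod]
  exact (hW.comp hm).aemeasurable

theorem NoiseLaw.lintegral_exp_sum_le {lam0 sig0 : ℝ} {ν : Measure ℝ} (hν : NoiseLaw lam0 sig0 ν)
    (hl : 0 < lam0) {ι : Type*} [Fintype ι] (A : Finset ι) {s : ℝ} (hs : |s| ≤ lam0 / 2) :
    ∫⁻ e, ENNReal.ofReal (Real.exp (s * ∑ j ∈ A, e j)) ∂(Measure.pi fun _ : ι => ν)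
      ≤ ENNReal.ofReal (Real.exp (A.card * (3 * sig0 / (2 * lam0 ^ 2) * s ^ 2))) := by
  classical
  have := hν.isProbability
  have h1 : ∀ e : ι → ℝ, ENNReal.ofReal (Real.exp (s * ∑ j ∈ A, e j)) =
      ∏ j, (if j ∈ A then fun y => ENNReal.ofReal (Real.exp (s * y)) else fun _ => 1) (e j) := by
    intro e
    rw [Finset.mul_sum, Real.exp_sum, ENNReal.ofReal_prod_of_nonneg fun _ _ => (Real.exp_pos _).le]
    rw [← Finset.prod_subset (Finset.subset_univ A)]
    · exact Finset.prod_congr rfl fun j hj => by simp [hj]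
    · intro j _ hj; simp [hj]
  have hg : ∀ j, Measurable (if j ∈ A then fun y => ENNReal.ofReal (Real.exp (s * y))
      else fun _ => 1) := by
    intro j; split_ifs <;> fun_prop
  rw [lintegral_congr h1, lintegral_pi_prod ν hg, Real.exp_nat_mul,
    ENNReal.ofReal_pow (Real.exp_pos _).le, ← Finset.prod_const,
    ← Finset.prod_subset (Finset.subset_univ A)]
  · refine Finset.prod_le_prod' fun j hj => ?_
    simpa [hj] using hν.lintegral_exp_mul_le hl hs
  · intro j _ hj; simp [hj]

/-- Neighbours are chosen from the covariates only, so given these the sum runs over a fixed set of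
min k n independent noises. The absolute value costs the factor 2, by exp(s|y|) ≤ exp(sy) +
exp(-sy). -/
theorem lintegral_exp_abs_noise_le {d n k : ℕ} {P : Measure (Cov d)} [IsProbabilityMeasure P]
    {lam0 sig0 : ℝ} {ν : Measure ℝ} (hν : NoiseLaw lam0 sig0 ν)
    (hl : 0 < lam0) {f : Cov d → ℝ} (hf : Measurable f) {s : ℝ} (hs : |s| ≤ lam0 / 2) (b : ℝ)
    (x : Cov d) :
    ∫⁻ S, ENNReal.ofReal (Real.exp (s * |neighbourSum k (fun z => z.2 - f z.1) S x| - b))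
        ∂(Measure.pi fun _ : Fin n => regressionLaw P f ν)
      ≤ ENNReal.ofReal (2 * Real.exp ((min k n : ℕ) * (3 * sig0 / (2 * lam0 ^ 2) * s ^ 2) - b)) := by
  have := hν.isProbability
  have hm : Measurable fun S : Fin n → Cov d × ℝ => neighbourSum k (fun z => z.2 - f z.1) S x :=
    (measurable_neighbourSum k
      (measurable_snd.sub (hf.comp measurable_fst))).comp (measurable_id.prodMk measurable_const)
  rw [lintegral_pi_regressionLaw P ν hf (by fun_prop)]
  have key : ∀ X : Fin n → Cov d, ∫⁻ e, ENNReal.ofReal (Real.exp (s * |neighbourSum k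
      (fun z => z.2 - f z.1) (fun i => (X i, f (X i) + e i)) x| - b))
        ∂(Measure.pi fun _ : Fin n => ν)
      ≤ ENNReal.ofReal (2 * Real.exp ((min k n : ℕ) * (3 * sig0 / (2 * lam0 ^ 2) * s ^ 2) - b)) := by
    intro X
    set A := neighbourSet k X x
    have hpt : ∀ e : Fin n → ℝ, ENNReal.ofReal (Real.exp (s * |neighbourSum k
        (fun z => z.2 - f z.1) (fun i => (X i, f (X i) + e i)) x| - b)) ≤
        ENNReal.ofReal (Real.exp (-b)) * (ENNReal.ofReal (Real.exp (s * ∑ j ∈ A, e j)) +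
          ENNReal.ofReal (Real.exp (-s * ∑ j ∈ A, e j))) := by
      intro e
      have hN : neighbourSum k (fun z => z.2 - f z.1) (fun i => (X i, f (X i) + e i)) x =
          ∑ j ∈ A, e j := by
        rw [neighbourSum_eq]
        exact Finset.sum_congr rfl fun j _ => by simp
      rw [hN, ← ENNReal.ofReal_add (Real.exp_pos _).le (Real.exp_pos _).le,
        ← ENNReal.ofReal_mul (Real.exp_pos _).le]
      apply ENNReal.ofReal_le_ofReal
      rw [sub_eq_add_neg, Real.exp_add, mul_comm]
      refine mul_le_mul_of_nonneg_left ?_ (Real.exp_pos _).le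
      rcases abs_cases (∑ j ∈ A, e j) with h | h <;> rw [h.1]
      · linarith [Real.exp_pos (-s * ∑ j ∈ A, e j)]
      · rw [mul_neg, neg_mul]
        linarith [Real.exp_pos (s * ∑ j ∈ A, e j)]
    refine (lintegral_mono hpt).trans ?_
    rw [lintegral_const_mul _ (by fun_prop), lintegral_add_left (by fun_prop)]
    have h1 := hν.lintegral_exp_sum_le hl A hs
    have h2 := hν.lintegral_exp_sum_le hl A (s := -s) (by rwa [abs_neg])
    rw [neg_sq] at h2
    refine (mul_le_mul_right (add_le_add h1 h2) _).trans_eq ?_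
    rw [← ENNReal.ofReal_add (Real.exp_pos _).le (Real.exp_pos _).le,
      ← ENNReal.ofReal_mul (Real.exp_pos _).le, card_neighbourSet, sub_eq_add_neg, Real.exp_add]
    congr 1; ring
  calc _ ≤ ∫⁻ _, _ ∂(Measure.pi fun _ : Fin n => P) := lintegral_mono key
    _ = _ := by simp

/-- The averaged squared noise term of the nearest neighbours is small with high probability. -/
theorem noise_bound {d n k : ℕ} {P Q : Measure (Cov d)} [IsProbabilityMeasure P]
    [IsProbabilityMeasure Q] {lam0 sig0 : ℝ} {ν : Measure ℝ} (hν : NoiseLaw lam0 sig0 ν)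
    (hl : 0 < lam0) {f : Cov d → ℝ} (hf : Measurable f) {τ c : ℝ} (hc : 3 ≤ c) (hcτ : τ + 3 ≤ c)
    (hn : 1 ≤ Real.log n) (hk : 8 / 3 * c * Real.log n ≤ (min k n : ℕ)) :
    (Measure.pi fun _ : Fin n => regressionLaw P f ν)
      {S | ¬ ∫⁻ x, ENNReal.ofReal (2 * neighbourSum k (fun z => z.2 - f z.1) S x ^ 2 / k) ∂Q
        ≤ ENNReal.ofReal (2 * (c / (lam0 ^ 2 / (8 * sig0))) * Real.log n)}
      ≤ ENNReal.ofReal ((n : ℝ) ^ (-τ)) := by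
  have := hν.isProbability
  have := isProbabilityMeasure_regressionLaw P ν hf
  have hs0 : 1 ≤ sig0 := hν.one_le hl
  set ℓ := Real.log n with hℓ
  set k' : ℝ := ((min k n : ℕ) : ℝ) with hk'
  have hk'pos : 0 < k' := lt_of_lt_of_le (by positivity) hk
  have hk'k : k' ≤ k := Nat.cast_le.2 (min_le_left k n)
  have hkpos : (0 : ℝ) < k := hk'pos.trans_le hk'k
  have hn0 : (0 : ℝ) < n := by
    rcases Nat.eq_zero_or_pos n with h | h
    · rw [hℓ, h] at hn; norm_num at hn
    · exact_mod_cast h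
  -- With this s the moment exponent equals c log n, half of b = 2 c log n, so W has expectation at
  -- most 2 exp(-c log n). The bound s ≤ lam0 / 2 follows from `hk` and 1 ≤ sig0.
  set s : ℝ := Real.sqrt (c * ℓ * (2 * lam0 ^ 2) / (3 * sig0 * k')) with hs
  have hspos : 0 < s := Real.sqrt_pos.2 (by positivity)
  have hssq : s ^ 2 = c * ℓ * (2 * lam0 ^ 2) / (3 * sig0 * k') := Real.sq_sqrt (by positivity)
  have hsle : |s| ≤ lam0 / 2 := by
    rw [abs_of_pos hspos]
    apply Real.sqrt_le_iff.2 ⟨by positivity, ?_⟩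
    rw [div_le_iff₀ (by positivity)]
    have h1 : 8 * c * ℓ ≤ 3 * (sig0 * k') := by nlinarith
    have h2 := mul_le_mul_of_nonneg_right h1 (by positivity : 0 ≤ lam0 ^ 2)
    nlinarith
  set b : ℝ := 2 * c * ℓ with hb
  have hb6 : 6 ≤ b := by nlinarith
  set N : (Fin n → Cov d × ℝ) → Cov d → ℝ := fun S x => neighbourSum k (fun z => z.2 - f z.1) S x
  have hNm : Measurable fun z : (Fin n → Cov d × ℝ) × Cov d => N z.1 z.2 :=
    measurable_neighbourSum k (measurable_snd.sub (hf.comp measurable_fst))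
  set W : (Fin n → Cov d × ℝ) → Cov d → ENNReal :=
    fun S x => ENNReal.ofReal (Real.exp (s * |N S x| - b))
  have hWm : Measurable (Function.uncurry W) := by
    change Measurable fun z : (Fin n → Cov d × ℝ) × Cov d =>
      ENNReal.ofReal (Real.exp (s * |N z.1 z.2| - b))
    fun_prop
  have hEW : ∀ x, ∫⁻ S, W S x ∂(Measure.pi fun _ : Fin n => regressionLaw P f ν)
      ≤ ENNReal.ofReal (2 * Real.exp (-(c * ℓ))) := by
    intro x
    refine (lintegral_exp_abs_noise_le hν hl hf hsle b x).trans_eq ?_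
    congr 3
    rw [hssq, hb]; field_simp; ring
  -- The factor 3/4 pays for 1 + (1/2)(2/3) = 4/3, which arises from the Markov threshold 2/3 below.
  have hA : 2 * (b ^ 2 / s ^ 2) / k ≤ 3 / 4 * (2 * (c / (lam0 ^ 2 / (8 * sig0))) * ℓ) := by
    have : b ^ 2 / s ^ 2 = 6 * c * sig0 * ℓ / lam0 ^ 2 * k' := by
      rw [hssq, hb]; field_simp; ring
    rw [this, div_le_iff₀ hkpos]
    calc _ ≤ 2 * (6 * c * sig0 * ℓ / lam0 ^ 2 * k) := by gcongr
      _ = _ := by field_simp; ring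
  refine (measure_mono ?_).trans ((measure_lintegral_ge_le _ Q hWm hEW
    (c := ENNReal.ofReal (2 / 3)) (by simp) ENNReal.ofReal_ne_top).trans ?_)
  · intro S hS
    by_contra hlt
    apply hS
    have hlt : ∫⁻ x, W S x ∂Q ≤ ENNReal.ofReal (2 / 3) := (not_le.1 hlt).le
    have hpt : ∀ x, ENNReal.ofReal (2 * N S x ^ 2 / k) ≤
        ENNReal.ofReal (2 * (b ^ 2 / s ^ 2) / k) * (1 + ENNReal.ofReal (1 / 2) * W S x) := by
      intro x
      have h := sq_le_sq_mul_one_add_exp hb6 (by positivity : 0 ≤ s * |N S x|)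
      rw [← ENNReal.ofReal_one, ← ENNReal.ofReal_mul (by norm_num),
        ← ENNReal.ofReal_add (by norm_num) (by positivity), ← ENNReal.ofReal_mul (by positivity)]
      apply ENNReal.ofReal_le_ofReal
      rw [mul_pow, sq_abs] at h
      have h2 : N S x ^ 2 ≤ b ^ 2 / s ^ 2 * (1 + Real.exp (s * |N S x| - b) / 2) := by
        rw [div_mul_eq_mul_div, le_div_iff₀ (by positivity)]; linarith
      calc _ ≤ 2 * (b ^ 2 / s ^ 2 * (1 + Real.exp (s * |N S x| - b) / 2)) / k := by gcongr
        _ = _ := by ring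
    refine (lintegral_mono hpt).trans ?_
    have hWx : Measurable (W S) := hWm.of_uncurry_left
    rw [lintegral_const_mul _ (by fun_prop), lintegral_add_left measurable_const,
      lintegral_const_mul _ hWx, lintegral_one, measure_univ]
    calc _ ≤ ENNReal.ofReal (3 / 4 * (2 * (c / (lam0 ^ 2 / (8 * sig0))) * ℓ)) *
          (1 + ENNReal.ofReal (1 / 2) * ENNReal.ofReal (2 / 3)) := by gcongr
      _ = _ := by
        rw [← ENNReal.ofReal_one, ← ENNReal.ofReal_mul (by norm_num),
          ← ENNReal.ofReal_add (by norm_num) (by norm_num), ← ENNReal.ofReal_mul (by positivity)]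
        congr 1; ring
  · rw [← ENNReal.ofReal_div_of_pos (by norm_num)]
    apply ENNReal.ofReal_le_ofReal
    have h1 : (n : ℝ) ^ (-τ) = Real.exp (-(τ * ℓ)) := by
      rw [Real.rpow_def_of_pos hn0]; congr 1; ring
    have h2 : Real.exp (-(c * ℓ)) ≤ Real.exp (-(τ * ℓ)) * Real.exp (-3) := by
      rw [← Real.exp_add]; apply Real.exp_le_exp.2; nlinarith
    have h3 : 3 * Real.exp (-3) ≤ 1 := by
      have h4 : Real.exp 3 * Real.exp (-3) = 1 := by rw [← Real.exp_add]; simp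
      nlinarith [Real.add_one_le_exp (3 : ℝ), Real.exp_pos (-3)]
    rw [h1]
    nlinarith [Real.exp_pos (-(τ * ℓ))]

/-! ### The bias term -/

theorem HolderBall.measurable {d : ℕ} {β F L : ℝ} {f : Cov d → ℝ} (hf : HolderBall β F L f)
    (hβ : 0 < β) : Measurable f := by
  refine Continuous.measurable (continuous_iff_continuousAt.2 fun x => ?_)
  rw [ContinuousAt, tendsto_iff_dist_tendsto_zero]
  refine squeeze_zero (fun _ => dist_nonneg)
    (fun y => (Real.dist_eq _ _).trans_le (hf.holder y x)) ?_
  have h : Continuous fun y => L * ‖y - x‖ ^ β :=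
    continuous_const.mul ((continuous_id.sub continuous_const).norm.rpow_const
      fun _ => Or.inr hβ.le)
  simpa [Real.zero_rpow hβ.ne'] using h.tendsto x

/-- The probability that fewer than `k` of `n` sample points fall into a set of mass at least
`4 k / n` is controlled through an exponential moment. -/
theorem lintegral_prod_half_le {d n k : ℕ} {P : Measure (Cov d)} [IsProbabilityMeasure P]
    {ν : Measure ℝ} [IsProbabilityMeasure ν] {f : Cov d → ℝ} (hf : Measurable f) (hn : 0 < n)
    {B : Set (Cov d)} [DecidablePred (· ∈ B)] (hB : MeasurableSet B)
    (hP : 4 * (k : ℝ) / n ≤ P.real B) :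
    ∫⁻ S, ENNReal.ofReal (2 ^ k * ∏ j, if (S j).1 ∈ B then 1 / 2 else 1)
        ∂(Measure.pi fun _ : Fin n => regressionLaw P f ν)
      ≤ ENNReal.ofReal (Real.exp (-k)) := by
  have := isProbabilityMeasure_regressionLaw P ν hf
  have hg : Measurable fun z : Cov d × ℝ => ENNReal.ofReal (if z.1 ∈ B then 1 / 2 else 1) :=
    ENNReal.measurable_ofReal.comp
      (Measurable.ite (measurable_fst hB) measurable_const measurable_const)
  have h1 : ∀ S : Fin n → Cov d × ℝ,
      ENNReal.ofReal (2 ^ k * ∏ j, if (S j).1 ∈ B then 1 / 2 else 1) =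
        ENNReal.ofReal (2 ^ k) * ∏ j, ENNReal.ofReal (if (S j).1 ∈ B then 1 / 2 else 1) := by
    intro S
    rw [ENNReal.ofReal_mul (by positivity),
      ENNReal.ofReal_prod_of_nonneg fun j _ => by split_ifs <;> norm_num]
  -- One factor has mean 1 - P(B)/2 ≤ exp(-2k/n). The n factors give exp(-2k), and 2^k ≤ exp(k)
  -- leaves exp(-k).
  have h2 : ∫⁻ z, ENNReal.ofReal (if z.1 ∈ B then 1 / 2 else 1) ∂(regressionLaw P f ν)
      ≤ ENNReal.ofReal (Real.exp (-(2 * k / n))) := by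
    have h3 : ∀ y : Cov d, ENNReal.ofReal (if y ∈ B then 1 / 2 else 1) =
        B.indicator (fun _ => ENNReal.ofReal (1 / 2)) y + Bᶜ.indicator (fun _ => 1) y := by
      intro y; by_cases hy : y ∈ B <;> simp [hy]
    rw [regressionLaw, lintegral_map hg (by fun_prop), lintegral_prod
      (fun z : Cov d × ℝ => ENNReal.ofReal (if z.1 ∈ B then 1 / 2 else 1)) hg.aemeasurable]
    have h4 : ∀ y : Cov d, ∫⁻ _, ENNReal.ofReal (if y ∈ B then 1 / 2 else 1) ∂ν =
        ENNReal.ofReal (if y ∈ B then 1 / 2 else 1) := fun y => by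
      rw [lintegral_const, measure_univ, mul_one]
    refine (lintegral_congr h4).trans_le ?_
    rw [lintegral_congr h3, lintegral_add_left (measurable_const.indicator hB),
      lintegral_indicator hB, lintegral_indicator hB.compl, setLIntegral_const, setLIntegral_const,
      one_mul, ← ofReal_measureReal (μ := P) (s := B), ← ofReal_measureReal (μ := P) (s := Bᶜ),
      probReal_compl_eq_one_sub hB, ← ENNReal.ofReal_mul (by norm_num),
      ← ENNReal.ofReal_add (by positivity) (by linarith [measureReal_le_one (μ := P) (s := B)])]
    apply ENNReal.ofReal_le_ofReal
    have h4 := Real.add_one_le_exp (-(2 * (k : ℝ) / n))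
    have h5 : 4 * (k : ℝ) / n = 2 * (2 * k / n) := by ring
    linarith
  rw [lintegral_congr h1, lintegral_const_mul' _ _ ENNReal.ofReal_ne_top, lintegral_pi_prod (regressionLaw P f ν) (g := fun _ z =>
    ENNReal.ofReal (if z.1 ∈ B then 1 / 2 else 1)) fun _ => hg, Finset.prod_const,
    Finset.card_univ, Fintype.card_fin]
  calc _ ≤ ENNReal.ofReal (2 ^ k) * ENNReal.ofReal (Real.exp (-(2 * k / n))) ^ n := by gcongr
    _ ≤ _ := by
      rw [← ENNReal.ofReal_pow (Real.exp_pos _).le, ← ENNReal.ofReal_mul (by positivity),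
        ← Real.exp_nat_mul]
      apply ENNReal.ofReal_le_ofReal
      have h6 : (n : ℝ) * -(2 * k / n) = -(2 * k) := by
        have : (n : ℝ) ≠ 0 := by positivity
        field_simp
      have h7 : (2 : ℝ) ^ k ≤ Real.exp k := by
        rw [← Real.exp_one_pow]
        exact pow_le_pow_left₀ (by norm_num) (by linarith [Real.add_one_le_exp (1 : ℝ)]) k
      rw [h6]
      calc _ ≤ Real.exp k * Real.exp (-(2 * k)) := by gcongr
        _ = _ := by rw [← Real.exp_add]; congr 1; ring

/-- The Chernoff weight dominates the indicator of having at most k points in the set, and it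
factorises over the sample. -/
theorem one_le_two_pow_mul_prod_half {ι : Type*} [Fintype ι] {k : ℕ} {s : ι → Prop}
    [DecidablePred s] (h : (Finset.univ.filter s).card ≤ k) :
    (1 : ℝ) ≤ 2 ^ k * ∏ j, if s j then 1 / 2 else 1 := by
  rw [Finset.prod_ite, Finset.prod_const, Finset.prod_const_one, mul_one, one_div, inv_pow,
    ← div_eq_mul_inv, one_le_div (by positivity)]
  exact pow_le_pow_right₀ (by norm_num) h

theorem ClassP.density_mul_le_one {d : ℕ} {pbar am rm ap rp : ℝ} {P : Measure (Cov d)}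
    {p : Cov d → ℝ} (hP : ClassP pbar am rm ap rp P p) (hrm : 0 < rm) (x : Cov d) :
    am * p x * rm ^ d ≤ 1 := by
  have := hP.isProbability
  exact (hP.minimal_mass x rm hrm le_rfl).trans measureReal_le_one

theorem abs_neighbourSum_sub_le {d n k : ℕ} {β F L : ℝ} {f : Cov d → ℝ} (hf : HolderBall β F L f)
    (hF : 0 < F) (S : Fin n → Cov d × ℝ) (x : Cov d) :
    |neighbourSum k (fun z => f z.1) S x - k * f x| ≤ 2 * F * k := by
  rw [neighbourSum_eq]
  have h1 : |∑ j ∈ neighbourSet k (fun j => (S j).1) x, f (S j).1| ≤ k * F := by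
    calc _ ≤ ∑ j ∈ neighbourSet k (fun j => (S j).1) x, |f (S j).1| :=
          Finset.abs_sum_le_sum_abs _ _
      _ ≤ ∑ j ∈ neighbourSet k (fun j => (S j).1) x, F :=
          Finset.sum_le_sum fun j _ => hf.bounded _
      _ ≤ k * F := by
          rw [Finset.sum_const, card_neighbourSet, nsmul_eq_mul]
          gcongr
          exact min_le_left k n
  have h2 : |k * f x| ≤ k * F := by
    rw [abs_mul, Nat.abs_cast]
    exact mul_le_mul_of_nonneg_left (hf.bounded x) (by positivity)
  linarith [abs_sub (∑ j ∈ neighbourSet k (fun j => (S j).1) x, f (S j).1) (k * f x)]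

theorem abs_neighbourSum_sub_le_of_card {d n k : ℕ} {β F L : ℝ} {f : Cov d → ℝ}
    (hf : HolderBall β F L f) (hβ : 0 < β) (hL : 0 < L) (S : Fin n → Cov d × ℝ) (x : Cov d) {r : ℝ}
    (h : k ≤ (Finset.univ.filter fun j => ‖x - (S j).1‖ ≤ r).card) :
    |neighbourSum k (fun z => f z.1) S x - k * f x| ≤ k * (L * r ^ β) := by
  have hkn : min k n = k := min_eq_left (h.trans ((Finset.card_le_univ _).trans_eq (by simp)))
  have hcard := card_neighbourSet k (fun j => (S j).1) x
  rw [hkn] at hcard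
  have h1 : neighbourSum k (fun z => f z.1) S x - k * f x =
      ∑ j ∈ neighbourSet k (fun j => (S j).1) x, (f (S j).1 - f x) := by
    rw [neighbourSum_eq, Finset.sum_sub_distrib, Finset.sum_const, hcard, nsmul_eq_mul]
  rw [h1]
  calc _ ≤ ∑ j ∈ neighbourSet k (fun j => (S j).1) x, |f (S j).1 - f x| :=
        Finset.abs_sum_le_sum_abs _ _
    _ ≤ ∑ j ∈ neighbourSet k (fun j => (S j).1) x, L * r ^ β := by
        refine Finset.sum_le_sum fun j hj => ?_
        have h2 := norm_sub_le_of_mem_neighbourSet h hj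
        rw [abs_sub_comm]
        refine (hf.holder _ _).trans ?_
        gcongr
    _ = _ := by rw [Finset.sum_const, hcard, nsmul_eq_mul]

/-- The averaged squared bias of the nearest neighbours is small with high probability. -/
theorem bias_bound {d n k : ℕ} (hd : 1 ≤ d) {pbar am rm ap rp : ℝ} (ham : 0 < am) (hrm : 0 < rm)
    {P Q : Measure (Cov d)} {p q : Cov d → ℝ} (hP : ClassP pbar am rm ap rp P p)
    (hQ : IsBoundedDensity pbar Q q) {ν : Measure ℝ} [IsProbabilityMeasure ν]
    {β F L : ℝ} (hβ : 0 < β) (hF : 0 < F) (hL : 0 < L) {f : Cov d → ℝ} (hf : HolderBall β F L f)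
    {u : ℝ} (hu : 0 < u) (hu2 : u ≤ 2 * β / d) (hT : ratioIntegral p q u ≠ ⊤) (hn : 0 < n)
    (hk : 0 < k) {ζ : ℝ} (hζ : 0 < ζ) :
    (Measure.pi fun _ : Fin n => regressionLaw P f ν)
      {S | ¬ ∫⁻ x, ENNReal.ofReal
          (2 * (neighbourSum k (fun z => f z.1) S x - k * f x) ^ 2 / k) ∂Q
        ≤ ENNReal.ofReal (k * (2 * L ^ 2 * rm ^ (2 * β) + 8 * F ^ 2) *
          ((4 * k / n / (am * rm ^ d)) ^ u * (ratioIntegral p q u).toReal + ζ))}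
      ≤ ENNReal.ofReal (Real.exp (-k) / ζ) := by
  classical
  have := hP.isProbability
  have := hQ.isProbability
  have hfm := hf.measurable hβ
  have := isProbabilityMeasure_regressionLaw P ν hfm
  have hk' : (0 : ℝ) < k := by exact_mod_cast hk
  have hn' : (0 : ℝ) < n := by exact_mod_cast hn
  have hd' : (0 : ℝ) < d := by exact_mod_cast hd
  have hpm := hP.measurable
  -- Chosen so that R x ≤ rm exactly when c ≤ p x (for p x > 0), in which case the minimal mass at
  -- radius R x is am * p x * rm ^ d * (c / p x) = 4k/n.
  set c : ℝ := 4 * k / n / (am * rm ^ d) with hc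
  have hcpos : 0 < c := by positivity
  set R : Cov d → ℝ := fun x => rm * (c / p x) ^ (1 / (d : ℝ)) with hR
  have hRm : Measurable R := by fun_prop
  set W : (Fin n → Cov d × ℝ) → Cov d → ENNReal := fun S x =>
    if c ≤ p x then
      ENNReal.ofReal (2 ^ k * ∏ j, if (S j).1 ∈ Metric.closedBall x (R x) then 1 / 2 else 1)
    else 0 with hW
  have hWm : Measurable (Function.uncurry W) := by
    refine Measurable.ite (measurableSet_le measurable_const (hpm.comp measurable_snd))
      (ENNReal.measurable_ofReal.comp (measurable_const.mul
        (Finset.measurable_prod _ fun j _ => ?_))) measurable_const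
    refine Measurable.ite ?_ measurable_const measurable_const
    exact measurableSet_le (f := fun z : (Fin n → Cov d × ℝ) × Cov d => dist (z.1 j).1 z.2)
      (g := fun z => R z.2) (by fun_prop) (hRm.comp measurable_snd)
  have hEW : ∀ x, ∫⁻ S, W S x ∂(Measure.pi fun _ : Fin n => regressionLaw P f ν)
      ≤ ENNReal.ofReal (Real.exp (-k)) := by
    intro x
    by_cases hx : c ≤ p x
    · simp only [hW, hx, if_true]
      refine lintegral_prod_half_le hfm hn Metric.isClosed_closedBall.measurableSet ?_
      have hp0 : 0 < p x := hcpos.trans_le hx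
      have hle1 : (c / p x) ^ (1 / (d : ℝ)) ≤ 1 :=
        Real.rpow_le_one (by positivity) ((div_le_one hp0).2 hx) (by positivity)
      refine le_trans (le_of_eq ?_) (hP.minimal_mass x (R x) (by positivity) ?_)
      · rw [hR]
        simp only
        rw [mul_pow, ← Real.rpow_natCast (_ ^ _) d, ← Real.rpow_mul (by positivity),
          one_div, inv_mul_cancel₀ hd'.ne', Real.rpow_one, hc]
        field_simp
      · exact mul_le_of_le_one_right hrm.le hle1
    · simp [hW, hx]
  set M : ℝ := 2 * L ^ 2 * rm ^ (2 * β) + 8 * F ^ 2 with hM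
  have hMpos : 0 < M := by positivity
  -- This is (c / p)^u, infinite where p = 0. Where c ≤ p it dominates (c / p)^(2β/d), the scale of
  -- the squared Hölder bias; where p < c it is at least 1, so the crude bound is covered.
  set ρ : Cov d → ENNReal := fun x => ENNReal.ofReal (c ^ u) / ENNReal.ofReal (p x) ^ u with hρ
  have hρm : Measurable ρ := by fun_prop
  have hρint : ∫⁻ x, ρ x ∂Q = ENNReal.ofReal (c ^ u * (ratioIntegral p q u).toReal) := by
    rw [ENNReal.ofReal_mul (by positivity), ENNReal.ofReal_toReal hT, hQ.eq_withDensity,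
      lintegral_withDensity_eq_lintegral_mul _ (hQ.measurable.ennreal_ofReal) hρm, ratioIntegral,
      ← lintegral_const_mul _ (by have := hQ.measurable; fun_prop)]
    refine lintegral_congr fun x => ?_
    simp only [hρ, Pi.mul_apply, div_eq_mul_inv]
    ring
  have hρeq : ∀ x, 0 < p x → ρ x = ENNReal.ofReal ((c / p x) ^ u) := by
    intro x hx
    rw [hρ]
    simp only
    rw [ENNReal.ofReal_rpow_of_pos hx, ← ENNReal.ofReal_div_of_pos (by positivity),
      Real.div_rpow hcpos.le hx.le]
  have hpt : ∀ S x, ENNReal.ofReal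
      (2 * (neighbourSum k (fun z => f z.1) S x - k * f x) ^ 2 / k) ≤
      ENNReal.ofReal (k * M) * (ρ x + W S x) := by
    intro S x
    have hcoarse : ENNReal.ofReal (2 * (neighbourSum k (fun z => f z.1) S x - k * f x) ^ 2 / k) ≤
        ENNReal.ofReal (k * M) := by
      apply ENNReal.ofReal_le_ofReal
      rw [div_le_iff₀ hk', ← sq_abs]
      have h1 := pow_le_pow_left₀ (abs_nonneg _) (abs_neighbourSum_sub_le (k := k) hf hF S x) 2
      have h2 : 0 ≤ 2 * L ^ 2 * rm ^ (2 * β) * (k * k) := by positivity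
      rw [hM]; nlinarith
    by_cases hx : c ≤ p x
    · by_cases hcard : (Finset.univ.filter fun j => ‖x - (S j).1‖ ≤ R x).card ≤ k - 1
      · have h1 : 1 ≤ W S x := by
          simp only [hW, hx, if_true]
          rw [← ENNReal.ofReal_one]
          apply ENNReal.ofReal_le_ofReal
          apply one_le_two_pow_mul_prod_half
          simp only [Metric.mem_closedBall, dist_comm _ x, dist_eq_norm]
          omega
        calc _ ≤ ENNReal.ofReal (k * M) * 1 := by rw [mul_one]; exact hcoarse
          _ ≤ _ := by gcongr; exact h1.trans le_add_self
      · have hp0 : 0 < p x := hcpos.trans_le hx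
        have h1 := abs_neighbourSum_sub_le_of_card (k := k) hf hβ hL S x (r := R x) (by omega)
        calc _ ≤ ENNReal.ofReal (k * M) * ρ x := ?_
          _ ≤ _ := by gcongr; exact le_self_add
        rw [hρeq x hp0, ← ENNReal.ofReal_mul (by positivity)]
        apply ENNReal.ofReal_le_ofReal
        have h2 := pow_le_pow_left₀ (abs_nonneg _) h1 2
        rw [sq_abs] at h2
        have h3 : (R x ^ β) ^ 2 = rm ^ (2 * β) * (c / p x) ^ (2 * β / d) := by
          rw [hR]
          simp only
          rw [← Real.rpow_natCast (_ ^ β) 2, ← Real.rpow_mul (by positivity),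
            Real.mul_rpow hrm.le (by positivity), ← Real.rpow_mul (by positivity)]
          push_cast
          congr 2 <;> ring
        have h4 : (c / p x) ^ (2 * β / d) ≤ (c / p x) ^ u :=
          Real.rpow_le_rpow_of_exponent_ge (by positivity) ((div_le_one hp0).2 hx) hu2
        rw [div_le_iff₀ hk']
        calc _ ≤ 2 * (k * (L * R x ^ β)) ^ 2 := by gcongr
          _ = 2 * L ^ 2 * rm ^ (2 * β) * (c / p x) ^ (2 * β / d) * (k * k) := by
              rw [mul_pow, mul_pow, h3]; ring
          _ ≤ 2 * L ^ 2 * rm ^ (2 * β) * (c / p x) ^ u * (k * k) := by gcongr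
          _ ≤ 2 * L ^ 2 * rm ^ (2 * β) * (c / p x) ^ u * (k * k) +
              8 * F ^ 2 * (c / p x) ^ u * (k * k) := le_add_of_nonneg_right (by positivity)
          _ = _ := by rw [hM]; ring
    · have h1 : 1 ≤ ρ x := by
        rw [hρ]
        simp only
        have hpc : ENNReal.ofReal (p x) ^ u ≤ ENNReal.ofReal (c ^ u) := by
          rw [← ENNReal.ofReal_rpow_of_pos hcpos]
          gcongr
          exact (not_le.1 hx).le
        rw [ENNReal.le_div_iff_mul_le (Or.inr (by positivity)) (Or.inr ENNReal.ofReal_ne_top),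
          one_mul]
        exact hpc
      calc _ ≤ ENNReal.ofReal (k * M) * 1 := by rw [mul_one]; exact hcoarse
        _ ≤ _ := by gcongr; exact h1.trans le_self_add
  refine (measure_mono ?_).trans ((measure_lintegral_ge_le _ Q hWm hEW
    (c := ENNReal.ofReal ζ) (by simpa using hζ) ENNReal.ofReal_ne_top).trans_eq
      (ENNReal.ofReal_div_of_pos hζ).symm)
  intro S hS
  by_contra hlt
  apply hS
  have hlt : ∫⁻ x, W S x ∂Q ≤ ENNReal.ofReal ζ := (not_le.1 hlt).le
  refine (lintegral_mono (hpt S)).trans ?_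
  rw [lintegral_const_mul' _ _ ENNReal.ofReal_ne_top, lintegral_add_left hρm, hρint,
    ENNReal.ofReal_mul (p := k * M) (by positivity), ENNReal.ofReal_add (by positivity) hζ.le]
  gcongr

/-! ### Constants and the choice of the number of neighbours -/

/-- In terms of A the constant is 8 + 8A/3. The value 8 is twice the 4 of the mass condition 4k/n;
the spare factor 2 absorbs the rounding of k and the Markov threshold ζ. -/
theorem eight_le_radiusConst {d : ℕ} (hd : 1 ≤ d) {τ K : ℝ} (hτ : 0 < τ) (hK : 1 ≤ K) :
    8 ≤ radiusConst d τ K := by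
  have hd' : (1 : ℝ) ≤ d := by exact_mod_cast hd
  have h1 : 1 ≤ coveringConst d K := by
    have h2 : (1 : ℝ) ≤ (4 * Real.exp 1) ^ (2 * d + 1) :=
      one_le_pow₀ (by linarith [Real.add_one_le_exp (1 : ℝ)])
    have h3 : 1 ≤ 2 * K * (2 * d + 1) := by nlinarith
    exact one_le_mul_of_one_le_of_one_le h3 h2
  have h2 : 0 ≤ Real.log (coveringConst d K) / Real.log (2 * d) :=
    div_nonneg (Real.log_nonneg h1) (Real.log_nonneg (by linarith))
  set A := 2 * d + τ + Real.log (coveringConst d K) / Real.log (2 * d) with hA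
  have hA0 : 0 ≤ A := by positivity
  have h3 : radiusConst d τ K = 2 * (4 * A + 12) / 3 := by
    rw [radiusConst, lambdaPlus, ← hA, one_sub_div (by positivity)]
    have : 4 * A + 12 - (4 * A + 9) = 3 := by ring
    rw [this]; field_simp
  rw [h3]; linarith

theorem eventually_mul_log_le_rpow (C : ℝ) {κ a : ℝ} (hκ : 0 < κ) (ha : 0 < a) :
    ∀ᶠ n : ℕ in Filter.atTop, C * Real.log n ≤ κ * (n : ℝ) ^ a := by
  have hC : 0 < |C| + 1 := by positivity
  have h := ((isLittleO_log_rpow_atTop ha).def (div_pos hκ hC))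
  filter_upwards [tendsto_natCast_atTop_atTop.eventually h,
    tendsto_natCast_atTop_atTop.eventually (Filter.eventually_ge_atTop (1 : ℝ))] with n hn hn1
  have hlog : 0 ≤ Real.log n := Real.log_nonneg hn1
  rw [Real.norm_of_nonneg hlog, Real.norm_of_nonneg (by positivity), div_mul_eq_mul_div,
    le_div_iff₀ hC] at hn
  nlinarith [le_abs_self C]

/-- For large samples the number of neighbours is large and close to its target. -/
theorem exists_sample_size (τ c : ℝ) {u κ : ℝ} (hu : 0 < u) (hκ : 0 < κ) :
    ∃ N : ℕ, ∀ n ≥ N, 1 ≤ Real.log n ∧ ∀ ℓ, Real.log n ≤ ℓ → ∀ k : ℕ,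
      k = ⌈κ * ℓ ^ (1 / (u + 1)) * (n : ℝ) ^ (u / (u + 1))⌉₊ →
      8 / 3 * c * Real.log n ≤ (min k n : ℕ) ∧
      ∃ ζ, 0 < ζ ∧ Real.exp (-k) / ζ ≤ (n : ℝ) ^ (-τ) ∧
        k * ((4 * k / n) ^ u + ζ) ≤ κ * ℓ * (8 * κ) ^ u := by
  have hu1 : 0 < u + 1 := by linarith
  set a := u / (u + 1) with ha
  have ha0 : 0 < a := by positivity
  have ha1 : a ≤ 1 := (div_le_one hu1).2 (by linarith)
  -- Rounding up costs at most a factor D. It enters to the power u + 1, and D ^ (u + 1) = 2 ^ (u /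
  -- 2) uses only part of the slack 2 ^ u; `g` is built from the rest.
  set D : ℝ := 2 ^ (a / 2) with hD
  have hD1 : 1 < D := Real.one_lt_rpow (by norm_num) (by positivity)
  have hD2 : D ≤ 2 := by
    calc D ≤ 2 ^ (1 : ℝ) := Real.rpow_le_rpow_of_exponent_le (by norm_num) (by linarith)
      _ = 2 := Real.rpow_one 2
  have hDu : D ^ (u + 1) = 2 ^ (u / 2) := by
    rw [hD, ← Real.rpow_mul (by norm_num), ha]; congr 1; field_simp
  have hE : (2 : ℝ) ^ (u / 2) < 2 ^ u := Real.rpow_lt_rpow_of_exponent_lt (by norm_num) (by linarith)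
  set g : ℝ := κ ^ u * 4 ^ u * (2 ^ u - 2 ^ (u / 2)) / 2 with hg
  have hgpos : 0 < g := by
    have : 0 < (2 : ℝ) ^ u - 2 ^ (u / 2) := by linarith
    positivity
  rw [← Filter.eventually_atTop]
  filter_upwards [(Real.tendsto_log_atTop.comp tendsto_natCast_atTop_atTop).eventually
      (Filter.eventually_ge_atTop 1),
    eventually_mul_log_le_rpow (8 / 3 * c) hκ ha0, eventually_mul_log_le_rpow (τ + 2) hκ ha0,
    eventually_mul_log_le_rpow (1 / (D - 1)) hκ ha0,
    eventually_mul_log_le_rpow (8 / 3 * c) one_pos one_pos,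
    tendsto_natCast_atTop_atTop.eventually (Filter.eventually_ge_atTop (1 / g)),
    tendsto_natCast_atTop_atTop.eventually (Filter.eventually_ge_atTop (1 : ℝ))]
    with n hlog h1 h2 h3 h4 h5 hn1
  have hlog : 1 ≤ Real.log n := hlog
  refine ⟨hlog, fun ℓ hℓ k hk => ?_⟩
  have hℓ1 : 1 ≤ ℓ := hlog.trans hℓ
  have hn0 : (0 : ℝ) < n := by linarith
  set y := κ * ℓ ^ (1 / (u + 1)) * (n : ℝ) ^ a with hy
  have hy0 : κ * (n : ℝ) ^ a ≤ y := by
    have : 1 ≤ ℓ ^ (1 / (u + 1)) := Real.one_le_rpow hℓ1 (by positivity)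
    rw [hy]
    have h6 : 0 < κ * (n : ℝ) ^ a := by positivity
    nlinarith
  have hypos : 0 < y := lt_of_lt_of_le (by positivity) hy0
  have hyk : y ≤ k := by rw [hk]; exact Nat.le_ceil y
  have hky : k ≤ D * y := by
    have h6 : (k : ℝ) < y + 1 := by rw [hk]; exact Nat.ceil_lt_add_one hypos.le
    have h7 : 1 / (D - 1) ≤ y := by
      refine le_trans ?_ (h3.trans hy0)
      exact le_mul_of_one_le_right (by have : 0 < D - 1 := by linarith
                                       positivity) hlog
    rw [div_le_iff₀ (by linarith)] at h7
    linarith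
  -- The balance that defines the number of neighbours: the powers of n cancel and exactly one
  -- factor ℓ remains.
  have hyy : y * (y / n) ^ u = κ * κ ^ u * ℓ := by
    have hℓ0 : 0 < ℓ := by linarith
    rw [Real.div_rpow hypos.le hn0.le]
    have h6 : y ^ u = κ ^ u * ℓ ^ (1 / (u + 1) * u) * (n : ℝ) ^ (a * u) := by
      rw [hy, Real.mul_rpow (by positivity) (by positivity), Real.mul_rpow hκ.le (by positivity),
        ← Real.rpow_mul hℓ0.le, ← Real.rpow_mul hn0.le]
    have h7 : ℓ ^ (1 / (u + 1)) * ℓ ^ (1 / (u + 1) * u) = ℓ := by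
      rw [← Real.rpow_add hℓ0]
      convert Real.rpow_one ℓ using 2
      field_simp; ring
    have h8 : (n : ℝ) ^ a * (n : ℝ) ^ (a * u) = (n : ℝ) ^ u := by
      rw [← Real.rpow_add hn0, ha]; congr 1; field_simp; ring
    rw [mul_div_assoc', div_eq_iff (by positivity), h6, hy]
    calc _ = κ * κ ^ u * (ℓ ^ (1 / (u + 1)) * ℓ ^ (1 / (u + 1) * u)) *
          ((n : ℝ) ^ a * (n : ℝ) ^ (a * u)) := by ring
      _ = _ := by rw [h7, h8]
  have hyn : y ≤ κ * ℓ * n := by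
    have h6 : ℓ ^ (1 / (u + 1)) ≤ ℓ := by
      calc _ ≤ ℓ ^ (1 : ℝ) := Real.rpow_le_rpow_of_exponent_le hℓ1
            ((div_le_one hu1).2 (by linarith))
        _ = ℓ := Real.rpow_one ℓ
    have h7 : (n : ℝ) ^ a ≤ n := by
      calc _ ≤ (n : ℝ) ^ (1 : ℝ) := Real.rpow_le_rpow_of_exponent_le hn1 ha1
        _ = n := Real.rpow_one _
    rw [hy]; gcongr
  -- With ζ = g / n, k ≤ 2y ≤ 2κℓn keeps kζ within the slack, while exp(-k) ≤ n^(-τ-2) makes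
  -- division by ζ harmless once n ≥ 1/g.
  refine ⟨?_, g / n, by positivity, ?_, ?_⟩
  · rw [Nat.cast_min]
    exact le_min (h1.trans (hy0.trans hyk)) (by simpa using h4)
  · rw [div_le_iff₀ (by positivity), Real.rpow_def_of_pos hn0]
    have h6 : 1 / (n : ℝ) ^ 2 ≤ g / n := by
      rw [div_le_iff₀ hgpos] at h5
      rw [div_le_div_iff₀ (by positivity) hn0]
      nlinarith
    calc Real.exp (-k) ≤ Real.exp (Real.log n * -τ + -(Real.log n * 2)) :=
          Real.exp_le_exp.2 (by linarith)
      _ = Real.exp (Real.log n * -τ) * (1 / (n : ℝ) ^ 2) := by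
          rw [Real.exp_add, Real.exp_neg, ← Real.rpow_def_of_pos hn0, one_div,
            mul_comm (Real.log n) 2, ← Real.log_rpow hn0, Real.exp_log (by positivity),
            Real.rpow_two]
      _ ≤ _ := by gcongr
  · have h6 : k * (4 * k / n) ^ u ≤ 2 ^ (u / 2) * 4 ^ u * (κ * κ ^ u * ℓ) := by
      calc _ ≤ (D * y) * (4 * (D * y) / n) ^ u := by gcongr
        _ = (D * y) * ((D * 4) * (y / n)) ^ u := by congr 2; ring
        _ = (D ^ u * D) * 4 ^ u * (y * (y / n) ^ u) := by
            rw [Real.mul_rpow (by positivity) (by positivity),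
              Real.mul_rpow (by positivity) (by positivity)]
            ring
        _ = _ := by
            rw [hyy, ← hDu, Real.rpow_add_one (by positivity)]
    have h7 : k * (g / n) ≤ 2 * g * (κ * ℓ) := by
      calc _ ≤ (2 * (κ * ℓ * n)) * (g / n) := by gcongr; nlinarith
        _ = _ := by field_simp
    have h8 : (8 * κ) ^ u = 2 ^ u * 4 ^ u * κ ^ u := by
      rw [← Real.mul_rpow (by norm_num) (by norm_num), ← Real.mul_rpow (by norm_num) hκ.le]
      norm_num
    rw [mul_add, h8]
    calc _ ≤ 2 ^ (u / 2) * 4 ^ u * (κ * κ ^ u * ℓ) + 2 * g * (κ * ℓ) := add_le_add h6 h7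
      _ = _ := by rw [hg]; ring

/-! ### The integrals 𝓣_P and 𝓣_Q -/

theorem lintegral_density_eq_one {d : ℕ} {pbar : ℝ} {Q : Measure (Cov d)} {q : Cov d → ℝ}
    (hQ : IsBoundedDensity pbar Q q) : ∫⁻ x, ENNReal.ofReal (q x) = 1 := by
  have := hQ.isProbability
  rw [← measure_univ (μ := Q), hQ.eq_withDensity, withDensity_apply _ .univ, setLIntegral_univ]

/-- Balls have mass at most 1, so p ≤ 1 / (am * rm ^ d) everywhere. This bound from below lets
additive errors be folded into the 𝓣 term. -/
theorem ofReal_rpow_le_ratioIntegral {d : ℕ} {pbar am rm ap rp : ℝ} (ham : 0 < am)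
    (hrm : 0 < rm) {P Q : Measure (Cov d)} {p q : Cov d → ℝ} (hP : ClassP pbar am rm ap rp P p)
    (hQ : IsBoundedDensity pbar Q q) {u : ℝ} (hu : 0 < u) :
    ENNReal.ofReal ((am * rm ^ d) ^ u) ≤ ratioIntegral p q u := by
  have hh : 0 < am * rm ^ d := by positivity
  calc _ = ∫⁻ x, ENNReal.ofReal (q x) * ENNReal.ofReal ((am * rm ^ d) ^ u) := by
        rw [lintegral_mul_const _ hQ.measurable.ennreal_ofReal, lintegral_density_eq_one hQ,
          one_mul]
    _ ≤ _ := by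
      refine lintegral_mono fun x => ?_
      rw [div_eq_mul_inv]
      refine mul_le_mul_right ?_ _
      rw [ENNReal.le_inv_iff_mul_le, ← ENNReal.ofReal_rpow_of_pos hh,
        ← ENNReal.mul_rpow_of_nonneg _ _ hu.le, ← ENNReal.ofReal_mul hh.le]
      refine ENNReal.rpow_le_one ?_ hu.le
      rw [ENNReal.ofReal_le_one]
      linarith [hP.density_mul_le_one hrm x]

/-- As p ≤ pbar, p^(-u) ≤ pbar^(γ-u) p^(-γ). -/
theorem ratioIntegral_lt_top {d : ℕ} {pbar γ u : ℝ} {p q : Cov d → ℝ} (hpbar : 0 < pbar)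
    (hp : ∀ x, p x ≤ pbar) (hu : 0 < u) (huγ : u ≤ γ)
    (h : ratioIntegral p q γ < ⊤) : ratioIntegral p q u < ⊤ := by
  set C := ENNReal.ofReal (pbar ^ (γ - u)) with hC
  have hC0 : C ≠ 0 := by rw [hC]; simpa using Real.rpow_pos_of_pos hpbar _
  have hCt : C ≠ ⊤ := ENNReal.ofReal_ne_top
  refine lt_of_le_of_lt ?_ (ENNReal.mul_lt_top (lt_top_iff_ne_top.2 hCt) h)
  rw [ratioIntegral, ratioIntegral, ← lintegral_const_mul' _ _ hCt]
  refine lintegral_mono fun x => ?_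
  have h1 : ENNReal.ofReal (p x) ^ γ ≤ C * ENNReal.ofReal (p x) ^ u := by
    have h2 : γ = (γ - u) + u := by ring
    calc ENNReal.ofReal (p x) ^ γ
        = ENNReal.ofReal (p x) ^ (γ - u) * ENNReal.ofReal (p x) ^ u := by
          rw [← ENNReal.rpow_add_of_nonneg _ _ (by linarith) hu.le, ← h2]
      _ ≤ _ := by
          rw [hC, ← ENNReal.ofReal_rpow_of_pos hpbar]
          gcongr
          exact hp x
  have h2 : (ENNReal.ofReal (p x) ^ u)⁻¹ ≤ C * (ENNReal.ofReal (p x) ^ γ)⁻¹ := by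
    calc _ = C * (C * ENNReal.ofReal (p x) ^ u)⁻¹ := by
          rw [ENNReal.mul_inv (Or.inl hC0) (Or.inl hCt), ← mul_assoc,
            ENNReal.mul_inv_cancel hC0 hCt, one_mul]
      _ ≤ _ := by gcongr
  rw [div_eq_mul_inv, div_eq_mul_inv]
  calc _ ≤ ENNReal.ofReal (q x) * (C * (ENNReal.ofReal (p x) ^ γ)⁻¹) := by gcongr
    _ = _ := by ring

/-- Makes the target sample the case P = Q. The condition v < 1 ensures that both integrands vanish
where q = 0. -/
theorem powerIntegral_eq_ratioIntegral {d : ℕ} {q : Cov d → ℝ} {v : ℝ} (hv1 : v < 1) :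
    powerIntegral q v = ratioIntegral q q v := by
  refine lintegral_congr fun x => ?_
  rcases eq_or_ne (ENNReal.ofReal (q x)) 0 with h | h
  · rw [h, ENNReal.zero_rpow_of_pos (by linarith), ENNReal.zero_div]
  · rw [ENNReal.rpow_sub _ _ h ENNReal.ofReal_ne_top, ENNReal.rpow_one]

theorem powerIntegral_lt_top {d : ℕ} {pbar e v : ℝ} {q : Cov d → ℝ} (hpbar : 0 < pbar)
    (hq : ∀ x, q x ≤ pbar) (he : 0 ≤ e) (hev : e ≤ 1 - v)
    (h : ∫⁻ x, ENNReal.ofReal (q x) ^ e < ⊤) : powerIntegral q v < ⊤ := by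
  have hCt : ENNReal.ofReal (pbar ^ (1 - v - e)) ≠ ⊤ := ENNReal.ofReal_ne_top
  refine lt_of_le_of_lt ?_ (ENNReal.mul_lt_top (lt_top_iff_ne_top.2 hCt) h)
  rw [powerIntegral, ← lintegral_const_mul' _ _ hCt]
  refine lintegral_mono fun x => ?_
  have h2 : 1 - v = (1 - v - e) + e := by ring
  calc ENNReal.ofReal (q x) ^ (1 - v)
      = ENNReal.ofReal (q x) ^ (1 - v - e) * ENNReal.ofReal (q x) ^ e := by
        rw [← ENNReal.rpow_add_of_nonneg _ _ (by linarith) he, ← h2]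
    _ ≤ _ := by
        rw [← ENNReal.ofReal_rpow_of_pos hpbar]
        gcongr
        exact hq x

/-! ### The one-sample bound -/

/-- The contribution of one sample to the risk of a nearest neighbours estimator. -/
theorem one_sample_bound {d n k : ℕ} (hd : 1 ≤ d) {τ K : ℝ} (hτ : 0 < τ) (hK : 1 ≤ K)
    {pbar am rm ap rp : ℝ} (ham : 0 < am) (hrm : 0 < rm)
    {P Q : Measure (Cov d)} {p q : Cov d → ℝ} (hP : ClassP pbar am rm ap rp P p)
    (hQ : IsBoundedDensity pbar Q q) {lam0 sig0 : ℝ} {ν : Measure ℝ}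
    (hν : NoiseLaw lam0 sig0 ν) (hl : 0 < lam0) {β F L : ℝ} (hβ : 0 < β) (hF : 0 < F) (hL : 0 < L)
    {f : Cov d → ℝ} (hf : HolderBall β F L f) {u κ : ℝ} (hu : 0 < u) (hu2 : u ≤ 2 * β / d)
    (hκ : 0 < κ) (hT : ratioIntegral p q u ≠ ⊤) {ℓ : ℝ} (hn : 1 ≤ Real.log n)
    (hℓ : Real.log n ≤ ℓ)
    (hk1 : 8 / 3 * (max 0 (Real.log (2 * (25 / (d : ℝ)) ^ d)) + 2 * d + τ + 1) * Real.log n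
      ≤ (min k n : ℕ))
    (hk2 : ∃ ζ, 0 < ζ ∧ Real.exp (-k) / ζ ≤ (n : ℝ) ^ (-τ) ∧
        k * ((4 * k / n) ^ u + ζ) ≤ κ * ℓ * (8 * κ) ^ u) :
    (Measure.pi fun _ : Fin n => regressionLaw P f ν)
      {S | ¬ ∫⁻ x, ENNReal.ofReal ((neighbourSum k (fun z => z.2 - f z.1) S x +
          (neighbourSum k (fun z => f z.1) S x - k * f x)) ^ 2 / k) ∂Q
        ≤ ENNReal.ofReal (ℓ * (κ * rateConst d τ K lam0 sig0 β F L am rm κ u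
          (ratioIntegral p q u).toReal))}
      ≤ ENNReal.ofReal (2 * (n : ℝ) ^ (-τ)) := by
  have := hP.isProbability
  have := hQ.isProbability
  have := hν.isProbability
  have hfm := hf.measurable hβ
  obtain ⟨ζ, hζ, hζ1, hζ2⟩ := hk2
  have hs0 : 1 ≤ sig0 := hν.one_le hl
  have hd' : (1 : ℝ) ≤ d := by exact_mod_cast hd
  set c := max 0 (Real.log (2 * (25 / (d : ℝ)) ^ d)) + 2 * d + τ + 1 with hc
  have hc3 : τ + 3 ≤ c := by
    have := le_max_left 0 (Real.log (2 * (25 / (d : ℝ)) ^ d)); linarith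
  have hkpos : 0 < min k n := by
    have h : (0 : ℝ) < (min k n : ℕ) := lt_of_lt_of_le (by positivity) hk1
    exact_mod_cast h
  have hk0 : 0 < k := lt_of_lt_of_le hkpos (min_le_left _ _)
  have hn0 : 0 < n := lt_of_lt_of_le hkpos (min_le_right _ _)
  have hN := noise_bound (P := P) (Q := Q) hν hl hfm (τ := τ) (by linarith) hc3 hn hk1
  have hB := (bias_bound hd ham hrm hP hQ (ν := ν) hβ hF hL hf hu hu2 hT hn0 hk0 hζ).trans
    (ENNReal.ofReal_le_ofReal hζ1)
  rw [two_mul, ENNReal.ofReal_add (by positivity) (by positivity)]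
  refine (measure_mono ?_).trans ((measure_union_le _ _).trans (add_le_add hN hB))
  intro S hS
  by_contra hS'
  simp only [Set.mem_union, Set.mem_ofPred_eq, not_or, not_not] at hS'
  apply hS
  obtain ⟨hS1, hS2⟩ := hS'
  set h := am * rm ^ d with hh
  have hh0 : 0 < h := by positivity
  set T := (ratioIntegral p q u).toReal with hTdef
  have hTh : h ^ u ≤ T := by
    have := ofReal_rpow_le_ratioIntegral ham hrm hP hQ hu
    rw [← ENNReal.ofReal_toReal hT] at this
    exact (ENNReal.ofReal_le_ofReal_iff ENNReal.toReal_nonneg).1 this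
  set M := 2 * L ^ 2 * rm ^ (2 * β) + 8 * F ^ 2 with hM
  have hM0 : 0 < M := by positivity
  have hpt : ∀ x, ENNReal.ofReal ((neighbourSum k (fun z => z.2 - f z.1) S x +
          (neighbourSum k (fun z => f z.1) S x - k * f x)) ^ 2 / k) ≤
      ENNReal.ofReal (2 * neighbourSum k (fun z => z.2 - f z.1) S x ^ 2 / k) +
      ENNReal.ofReal (2 * (neighbourSum k (fun z => f z.1) S x - k * f x) ^ 2 / k) := by
    intro x
    rw [← ENNReal.ofReal_add (by positivity) (by positivity), ← add_div]
    apply ENNReal.ofReal_le_ofReal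
    gcongr
    nlinarith [sq_nonneg (neighbourSum k (fun z => z.2 - f z.1) S x -
      (neighbourSum k (fun z => f z.1) S x - k * f x))]
  have hm : Measurable fun x => neighbourSum k (fun z => z.2 - f z.1) S x :=
    (measurable_neighbourSum k (measurable_snd.sub (hfm.comp measurable_fst))).comp
      (measurable_const.prodMk measurable_id)
  refine (lintegral_mono hpt).trans ?_
  rw [lintegral_add_left (by fun_prop)]
  refine (add_le_add hS1 hS2).trans ?_
  rw [← ENNReal.ofReal_add (by positivity) (by positivity)]
  apply ENNReal.ofReal_le_ofReal
  have hB8 := eight_le_radiusConst hd hτ hK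
  -- Since T' ≥ 1, ζ ≤ ζ T', so T' factors out and the sample-size inequality for k ((4k/n)^u + ζ)
  -- applies.
  set T' := T / h ^ u with hT'
  have hT'1 : 1 ≤ T' := (one_le_div (by positivity)).2 hTh
  have hℓ0 : 0 < ℓ := by linarith
  have h1 : k * M * ((4 * k / n / h) ^ u * T + ζ) ≤
      ℓ * κ * M * ((κ * radiusConst d τ K / h) ^ u * T) := by
    rw [Real.div_rpow (by positivity) hh0.le, Real.div_rpow (by positivity) hh0.le]
    calc _ = M * (k * ((4 * k / n) ^ u * T' + ζ)) := by rw [hT']; ring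
      _ ≤ M * (k * ((4 * k / n) ^ u * T' + ζ * T')) := by
          gcongr; exact le_mul_of_one_le_right hζ.le hT'1
      _ = M * T' * (k * ((4 * k / n) ^ u + ζ)) := by ring
      _ ≤ M * T' * (κ * ℓ * (8 * κ) ^ u) := by gcongr
      _ ≤ M * T' * (κ * ℓ * (κ * radiusConst d τ K) ^ u) := by
          gcongr M * T' * (κ * ℓ * ?_ ^ u); nlinarith
      _ = _ := by rw [hT']; ring
  have h2 : 2 * (c / (lam0 ^ 2 / (8 * sig0))) * Real.log n ≤
      2 * varianceConst d τ lam0 sig0 * ℓ := by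
    rw [varianceConst, ← hc]
    gcongr
  calc _ ≤ 2 * varianceConst d τ lam0 sig0 * ℓ +
        ℓ * κ * M * ((κ * radiusConst d τ K / h) ^ u * T) := add_le_add h2 h1
    _ = _ := by rw [rateConst, ← hM, ← hh]; field_simp

/-! ### Combination of the two samples -/

theorem add_sq_div_add_le {a b x y : ℝ} (hx : 0 < x) (hy : 0 < y) :
    (a + b) ^ 2 / (x + y) ≤ a ^ 2 / x + b ^ 2 / y := by
  rw [div_add_div _ _ hx.ne' hy.ne', div_le_div_iff₀ (by positivity) (by positivity)]
  nlinarith [mul_nonneg (by positivity : 0 ≤ x * y) (sq_nonneg (a * y - b * x)),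
    sq_nonneg (a * y - b * x), mul_pos hx hy]

theorem neighbourSum_snd {d n : ℕ} (k : ℕ) (f : Cov d → ℝ) (S : Fin n → Cov d × ℝ) (x : Cov d) :
    neighbourSum k (fun z => z.2) S x =
      neighbourSum k (fun z => z.2 - f z.1) S x + neighbourSum k (fun z => f z.1) S x := by
  simp only [neighbourSum_eq, ← Finset.sum_add_distrib, sub_add_cancel]

/-- The risk of the two-sample estimator is at most a weighted mean of one-sample risks. -/
theorem excessRisk_twoSampleKNN_le {d n m kP kQ : ℕ} (hkP : 0 < kP) (hkQ : 0 < kQ)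
    (Q : Measure (Cov d)) {f : Cov d → ℝ} (hf : Measurable f)
    (S : (Fin n → Cov d × ℝ) × (Fin m → Cov d × ℝ)) {a b : ℝ} (ha : 0 ≤ a) (hb : 0 ≤ b)
    (hP : ∫⁻ x, ENNReal.ofReal ((neighbourSum kP (fun z => z.2 - f z.1) S.1 x +
          (neighbourSum kP (fun z => f z.1) S.1 x - kP * f x)) ^ 2 / kP) ∂Q ≤ ENNReal.ofReal a)
    (hQ : ∫⁻ x, ENNReal.ofReal ((neighbourSum kQ (fun z => z.2 - f z.1) S.2 x +
          (neighbourSum kQ (fun z => f z.1) S.2 x - kQ * f x)) ^ 2 / kQ) ∂Q ≤ ENNReal.ofReal b) :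
    excessRisk Q (twoSampleKNN (fun _ => kP) (fun _ => kQ) S) f ≤
      ENNReal.ofReal ((a + b) / (kP + kQ)) := by
  have hkP' : (0 : ℝ) < kP := by exact_mod_cast hkP
  have hkQ' : (0 : ℝ) < kQ := by exact_mod_cast hkQ
  set U : Cov d → ℝ := fun x => neighbourSum kP (fun z => z.2 - f z.1) S.1 x +
    (neighbourSum kP (fun z => f z.1) S.1 x - kP * f x) with hU
  set V : Cov d → ℝ := fun x => neighbourSum kQ (fun z => z.2 - f z.1) S.2 x +
    (neighbourSum kQ (fun z => f z.1) S.2 x - kQ * f x) with hV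
  have hUm : Measurable U := by
    have h1 : Measurable fun x => neighbourSum kP (fun z => z.2 - f z.1) S.1 x :=
      (measurable_neighbourSum kP (measurable_snd.sub (hf.comp measurable_fst))).comp
        (measurable_const.prodMk measurable_id)
    have h2 : Measurable fun x => neighbourSum kP (fun z => f z.1) S.1 x :=
      (measurable_neighbourSum kP (hf.comp measurable_fst)).comp
        (measurable_const.prodMk measurable_id)
    fun_prop
  have hpt : ∀ x, ENNReal.ofReal ((twoSampleKNN (fun _ => kP) (fun _ => kQ) S x - f x) ^ 2) ≤
      ENNReal.ofReal (1 / (kP + kQ)) *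
        (ENNReal.ofReal (U x ^ 2 / kP) + ENNReal.ofReal (V x ^ 2 / kQ)) := by
    intro x
    rw [← ENNReal.ofReal_add (by positivity) (by positivity), ← ENNReal.ofReal_mul (by positivity)]
    apply ENNReal.ofReal_le_ofReal
    have h1 : twoSampleKNN (fun _ => kP) (fun _ => kQ) S x - f x = (U x + V x) / (kP + kQ) := by
      have h2 : twoSampleKNN (fun _ => kP) (fun _ => kQ) S x = 1 / ((kP : ℝ) + kQ) *
        (neighbourSum kP (fun z => z.2) S.1 x + neighbourSum kQ (fun z => z.2) S.2 x) := rfl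
      rw [h2, neighbourSum_snd kP f, neighbourSum_snd kQ f]
      simp only [hU, hV]
      field_simp
      ring
    rw [h1, div_pow, sq ((kP : ℝ) + kQ), ← div_div, div_eq_mul_one_div, mul_comm]
    gcongr
    exact add_sq_div_add_le hkP' hkQ'
  refine (lintegral_mono hpt).trans ?_
  rw [lintegral_const_mul' _ _ ENNReal.ofReal_ne_top, lintegral_add_left (by fun_prop)]
  refine (mul_le_mul_right (add_le_add hP hQ) _).trans_eq ?_
  rw [← ENNReal.ofReal_add ha hb, ← ENNReal.ofReal_mul (by positivity)]
  congr 1; ring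

/-- The threshold may depend on u only through u / (u + 1). This map is injective on u > 0, so u can
be recovered; for values not attained, 2d serves as a default. -/
theorem exists_threshold (d : ℕ) (τ c : ℝ) :
    ∃ N : ℝ → ℝ → ℕ, (∀ r κ, 2 * d ≤ N r κ) ∧ ∀ u κ : ℝ, 0 < u → 0 < κ →
      ∀ n ≥ N (u / (u + 1)) κ, 1 ≤ Real.log n ∧ ∀ ℓ, Real.log n ≤ ℓ → ∀ k : ℕ,
        k = ⌈κ * ℓ ^ (1 / (u + 1)) * (n : ℝ) ^ (u / (u + 1))⌉₊ →
        8 / 3 * c * Real.log n ≤ (min k n : ℕ) ∧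
        ∃ ζ, 0 < ζ ∧ Real.exp (-k) / ζ ≤ (n : ℝ) ^ (-τ) ∧
          k * ((4 * k / n) ^ u + ζ) ≤ κ * ℓ * (8 * κ) ^ u := by
  have h : ∀ r κ : ℝ, ∃ N : ℕ, 2 * d ≤ N ∧ ∀ u : ℝ, 0 < u → 0 < κ → u / (u + 1) = r →
      ∀ n ≥ N, 1 ≤ Real.log n ∧ ∀ ℓ, Real.log n ≤ ℓ → ∀ k : ℕ,
        k = ⌈κ * ℓ ^ (1 / (u + 1)) * (n : ℝ) ^ (u / (u + 1))⌉₊ →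
        8 / 3 * c * Real.log n ≤ (min k n : ℕ) ∧
        ∃ ζ, 0 < ζ ∧ Real.exp (-k) / ζ ≤ (n : ℝ) ^ (-τ) ∧
          k * ((4 * k / n) ^ u + ζ) ≤ κ * ℓ * (8 * κ) ^ u := by
    intro r κ
    by_cases h : ∃ u : ℝ, 0 < u ∧ 0 < κ ∧ u / (u + 1) = r
    · obtain ⟨u, hu, hκ, hr⟩ := h
      obtain ⟨N, hN⟩ := exists_sample_size τ c hu hκ
      refine ⟨max (2 * d) N, le_max_left _ _, fun u' hu' _ hr' n hn => ?_⟩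
      have huu : u' = u := by
        rw [← hr, div_eq_div_iff (by positivity) (by positivity)] at hr'
        linarith
      subst huu
      exact hN n ((le_max_right _ _).trans hn)
    · exact ⟨2 * d, le_rfl, fun u hu hκ hr => absurd ⟨u, hu, hκ, hr⟩ h⟩
  choose N hN1 hN2 using h
  exact ⟨N, hN1, fun u κ hu hκ n hn => hN2 _ κ u hu hκ rfl n hn⟩

theorem numNeighbours_ge {κ t : ℝ} {total s : ℕ} (ht : 0 < t) (hl : 0 < Real.log (total : ℝ)) :
    Real.log total * (κ * ((s : ℝ) / Real.log total) ^ (t / (t + 1))) ≤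
      numNeighbours κ t total s := by
  refine le_trans (le_of_eq ?_) (Nat.le_ceil _)
  set ℓ := Real.log (total : ℝ)
  have h1 : ℓ ^ (1 / (t + 1)) * ℓ ^ (t / (t + 1)) = ℓ := by
    rw [← Real.rpow_add hl, ← add_div, add_comm 1 t, div_self (by positivity), Real.rpow_one]
  rw [Real.div_rpow (by positivity) hl.le, ← mul_div_assoc, ← mul_div_assoc,
    div_eq_iff (by positivity)]
  calc _ = ℓ * κ * (s : ℝ) ^ (t / (t + 1)) := by ring
    _ = (ℓ ^ (1 / (t + 1)) * ℓ ^ (t / (t + 1))) * κ * (s : ℝ) ^ (t / (t + 1)) := by rw [h1]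
    _ = _ := by ring

theorem rateConst_nonneg {d : ℕ} {τ K lam0 sig0 β F L am rm κ t T : ℝ} (hd : 1 ≤ d) (hτ : 0 < τ)
    (hK : 1 ≤ K) (hs : 0 < sig0) (ham : 0 < am) (hrm : 0 < rm) (hκ : 0 < κ) (hT : 0 ≤ T) :
    0 ≤ rateConst d τ K lam0 sig0 β F L am rm κ t T := by
  have h8 := eight_le_radiusConst hd hτ hK
  have hv : 0 ≤ varianceConst d τ lam0 sig0 := by
    rw [varianceConst]
    have := le_max_left 0 (Real.log (2 * (25 / (d : ℝ)) ^ d))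
    positivity
  rw [rateConst]
  positivity

/-- The whole space is covered by E and two cylinders, so subadditivity suffices and no
measurability of E is needed. -/
theorem le_measureReal_of_compl_subset {α β : Type*} [MeasurableSpace α] [MeasurableSpace β]
    (μ : Measure α) (ν : Measure β) [IsProbabilityMeasure μ] [IsProbabilityMeasure ν]
    {E : Set (α × β)} {A : Set α} {B : Set β} {a b : ℝ} (ha : 0 ≤ a) (hb : 0 ≤ b)
    (hA : μ A ≤ ENNReal.ofReal a) (hB : ν B ≤ ENNReal.ofReal b)
    (hE : ∀ z : α × β, z.1 ∉ A → z.2 ∉ B → z ∈ E) :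
    1 - a - b ≤ (μ.prod ν).real E := by
  have h1 : (1 : ENNReal) ≤ μ.prod ν E + (μ A + ν B) := by
    calc (1 : ENNReal) = μ.prod ν Set.univ := measure_univ.symm
      _ ≤ μ.prod ν (E ∪ (A ×ˢ Set.univ ∪ Set.univ ×ˢ B)) := by
          refine measure_mono fun z _ => ?_
          by_cases h1 : z.1 ∈ A
          · exact Or.inr (Or.inl ⟨h1, trivial⟩)
          by_cases h2 : z.2 ∈ B
          · exact Or.inr (Or.inr ⟨trivial, h2⟩)
          exact Or.inl (hE z h1 h2)
      _ ≤ _ := by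
          refine (measure_union_le _ _).trans (add_le_add le_rfl ((measure_union_le _ _).trans ?_))
          rw [Measure.prod_prod, Measure.prod_prod, measure_univ, measure_univ, one_mul, mul_one]
  have h2 : ENNReal.ofReal 1 ≤ ENNReal.ofReal ((μ.prod ν).real E + (a + b)) := by
    rw [ENNReal.ofReal_one, ENNReal.ofReal_add measureReal_nonneg (by positivity),
      ENNReal.ofReal_add ha hb, ofReal_measureReal]
    exact h1.trans (add_le_add le_rfl (add_le_add hA hB))
  have h3 := (ENNReal.ofReal_le_ofReal_iff (by positivity)).1 h2
  linarith

theorem mainTheorem4 (d : ℕ) (hd : 1 ≤ d) (τ : ℝ) (hτ : 0 < τ) :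
    -- the thresholds `N(r_T, κ_P)` and `M(r_M, κ_Q)`
    ∃ N M : ℝ → ℝ → ℕ, (∀ r κ, 2 * d ≤ N r κ) ∧ (∀ r κ, 2 * d ≤ M r κ) ∧
    ∀ (K : ℝ), 1 ≤ K →
    ∀ (β F L : ℝ), 0 < β → β ≤ 1 → 0 < F → 0 < L →
    ∀ (lam0 sig0 : ℝ), 0 < lam0 → 0 < sig0 →
    ∀ (pbar am rm ap rp : ℝ), 0 < pbar → 0 < am → 0 < rm → 0 < ap → 0 < rp →
    ∀ (γ ρ : ℝ), 0 < γ → 0 < ρ →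
    ∀ (κP κQ : ℝ), 0 < κP → 0 < κQ →
    -- `u = u_T`, `v = u_M` is the optimal choice, for which `u / (u + 1) = r_T`,
    -- `v / (v + 1) = r_M`
    ∀ (u v : ℝ), 0 < u → u ≤ min γ (2 * β / d) → 0 < v → v ≤ min (ρ / (ρ + d)) (2 * β / d) →
    ∀ (P Q : Measure (Cov d)) (p q : Cov d → ℝ),
      ClassP pbar am rm ap rp P p → ClassQ pbar am rm ap rp p γ ρ Q q →
    ∀ (f : Cov d → ℝ), HolderBall β F L f →
    ∀ (ν : Measure ℝ), NoiseLaw lam0 sig0 ν →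
    ∀ (n m : ℕ), N (u / (u + 1)) κP ≤ n → M (v / (v + 1)) κQ ≤ m →
      1 - 2 * (n : ℝ) ^ (-τ) - 2 * (m : ℝ) ^ (-τ) ≤
        (twoSampleLaw n m P Q f ν).real
          {S | excessRisk Q
                (twoSampleKNN (fun _ => numNeighbours κP u (n + m) n)
                  (fun _ => numNeighbours κQ v (n + m) m) S) f ≤
            ENNReal.ofReal
              ((κP * rateConst d τ K lam0 sig0 β F L am rm κP u (ratioIntegral p q u).toReal +
                κQ * rateConst d τ K lam0 sig0 β F L am rm κQ v (powerIntegral q v).toReal) /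
                min κP κQ *
              (((n : ℝ) / Real.log ((n : ℝ) + m)) ^ (u / (u + 1)) +
                ((m : ℝ) / Real.log ((n : ℝ) + m)) ^ (v / (v + 1)))⁻¹)} := by
  obtain ⟨N, hN, hN'⟩ :=
    exists_threshold d τ (max 0 (Real.log (2 * (25 / (d : ℝ)) ^ d)) + 2 * d + τ + 1)
  refine ⟨N, N, hN, hN, ?_⟩
  intro K hK β F L hβ hβ1 hF hL lam0 sig0 hl hs pbar am rm ap rp hpbar ham hrm hap hrp γ ρ hγ hρ
    κP κQ hκP hκQ u v hu hu' hv hv' P Q p q hP hQ f hf ν hν n m hn hm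
  have := hP.isProbability
  have := hQ.isProbability
  have := hν.isProbability
  have hfm := hf.measurable hβ
  have := isProbabilityMeasure_regressionLaw P ν hfm
  have := isProbabilityMeasure_regressionLaw Q ν hfm
  obtain ⟨hlogn, hn2⟩ := hN' u κP hu hκP n hn
  obtain ⟨hlogm, hm2⟩ := hN' v κQ hv hκQ m hm
  have hn0 : (0 : ℝ) < n := by
    rcases Nat.eq_zero_or_pos n with h | h
    · rw [h] at hlogn; norm_num at hlogn
    · exact_mod_cast h
  have hm0 : (0 : ℝ) < m := by
    rcases Nat.eq_zero_or_pos m with h | h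
    · rw [h] at hlogm; norm_num at hlogm
    · exact_mod_cast h
  have hcast : Real.log ((n : ℝ) + m) = Real.log ((n + m : ℕ) : ℝ) := by push_cast; rfl
  rw [hcast]
  set ℓ := Real.log ((n + m : ℕ) : ℝ) with hℓ
  have hnℓ : Real.log n ≤ ℓ := Real.log_le_log hn0 (by push_cast; linarith)
  have hmℓ : Real.log m ≤ ℓ := Real.log_le_log hm0 (by push_cast; linarith)
  have hℓ0 : 0 < ℓ := by linarith
  have hv1 : v < 1 := by
    refine lt_of_le_of_lt (hv'.trans (min_le_left _ _)) ?_
    have hd' : (1 : ℝ) ≤ d := by exact_mod_cast hd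
    rw [div_lt_one (by positivity)]; linarith
  have hTP : ratioIntegral p q u ≠ ⊤ :=
    (ratioIntegral_lt_top hpbar hP.le_pbar hu (hu'.trans (min_le_left _ _))
      hQ.density_ratio).ne
  have hTQ : powerIntegral q v ≠ ⊤ := by
    have hd' : (1 : ℝ) ≤ d := by exact_mod_cast hd
    refine (powerIntegral_lt_top hpbar hQ.le_pbar (e := (d : ℝ) / (ρ + d)) (by positivity) ?_
      hQ.pseudo_moment).ne
    have h1 := hv'.trans (min_le_left _ _)
    have h2 : (d : ℝ) / (ρ + d) = 1 - ρ / (ρ + d) := by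
      rw [eq_sub_iff_add_eq, ← add_div, add_comm (d : ℝ), div_self (by positivity)]
    linarith
  have hTPQ := powerIntegral_eq_ratioIntegral (q := q) hv1
  set kP := numNeighbours κP u (n + m) n with hkP
  set kQ := numNeighbours κQ v (n + m) m with hkQ
  obtain ⟨hn3, hn4⟩ := hn2 ℓ hnℓ kP rfl
  obtain ⟨hm3, hm4⟩ := hm2 ℓ hmℓ kQ rfl
  have hA := one_sample_bound (Q := Q) (q := q) hd hτ hK ham hrm hP hQ.toIsBoundedDensity hν hl hβ
    hF hL hf hu (hu'.trans (min_le_right _ _)) hκP hTP hlogn hnℓ hn3 hn4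
  have hB := one_sample_bound (Q := Q) (q := q) hd hτ hK ham hrm hQ.toClassP hQ.toIsBoundedDensity
    hν hl hβ hF hL hf hv (hv'.trans (min_le_right _ _)) hκQ (hTPQ ▸ hTQ) hlogm hmℓ hm3 hm4
  rw [← hTPQ] at hB
  refine le_measureReal_of_compl_subset _ _ (by positivity) (by positivity) hA hB ?_
  intro S hS1 hS2
  simp only [Set.mem_ofPred_eq, not_not] at hS1 hS2
  set CP := rateConst d τ K lam0 sig0 β F L am rm κP u (ratioIntegral p q u).toReal
  set CQ := rateConst d τ K lam0 sig0 β F L am rm κQ v (powerIntegral q v).toReal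
  have hCP : 0 ≤ CP := rateConst_nonneg hd hτ hK hs ham hrm hκP ENNReal.toReal_nonneg
  have hCQ : 0 ≤ CQ := rateConst_nonneg hd hτ hK hs ham hrm hκQ ENNReal.toReal_nonneg
  have hgP : ℓ * (κP * ((n : ℝ) / ℓ) ^ (u / (u + 1))) ≤ kP := numNeighbours_ge hu hℓ0
  have hgQ : ℓ * (κQ * ((m : ℝ) / ℓ) ^ (v / (v + 1))) ≤ kQ := numNeighbours_ge hv hℓ0
  have hkP0 : 0 < kP := by
    have : (0 : ℝ) < kP := lt_of_lt_of_le (by positivity) hgP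
    exact_mod_cast this
  have hkQ0 : 0 < kQ := by
    have : (0 : ℝ) < kQ := lt_of_lt_of_le (by positivity) hgQ
    exact_mod_cast this
  refine (excessRisk_twoSampleKNN_le hkP0 hkQ0 Q hfm S (by positivity) (by positivity)
    hS1 hS2).trans (ENNReal.ofReal_le_ofReal ?_)
  set A := ((n : ℝ) / ℓ) ^ (u / (u + 1))
  set B := ((m : ℝ) / ℓ) ^ (v / (v + 1))
  have hA0 : 0 < A := by positivity
  have hB0 : 0 < B := by positivity
  set κ := min κP κQ
  have hκ0 : 0 < κ := lt_min hκP hκQ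
  -- Both sample sizes use the same ℓ = log(n + m), so it factors out here and cancels against the ℓ
  -- in the one-sample bounds.
  have hden : ℓ * (κ * (A + B)) ≤ kP + kQ := by
    have h1 : κ * A ≤ κP * A := by gcongr; exact min_le_left _ _
    have h2 : κ * B ≤ κQ * B := by gcongr; exact min_le_right _ _
    calc _ = ℓ * (κ * A) + ℓ * (κ * B) := by ring
      _ ≤ ℓ * (κP * A) + ℓ * (κQ * B) := by gcongr
      _ ≤ _ := add_le_add hgP hgQ
  calc _ ≤ (ℓ * (κP * CP) + ℓ * (κQ * CQ)) / (ℓ * (κ * (A + B))) := by gcongr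
    _ = _ := by field_simp
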